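/- Let $q>1$, $\gamma\in\mathbb R$ and $c=q^{-2\gamma}$. Write $(a;p)_n=\prod_{i=0}^{n-1}(1-ap^i)$, $(a;p)_\infty=\prod_{i\ge0}(1-ap^i)$, $(a_1,\dots,a_r;p)_\infty=\prod_j(a_j;p)_\infty$, and let ${}_2\varphi_1(a,b;0;p,z)$ denote the analytic continuation to $\mathbb C\setminus[1,\infty)$ of $\sum_{n\ge0}\frac{(a;p)_n(b;p)_n}{(p;p)_n}z^n$. On the extended lattice $x=x_{\sigma,k}=\sigma\sqrt c\,q^{-2k}$ ($\sigma=\pm1$, $k\in\mathbb Z$) define, for $m\in\mathbb Z$, $n\in\mathbb N=\{0,1,2,\dots\}$ and $\varepsilon_m=q^{2\gamma-2m}$, $$\tilde k_m(x_{\sigma,k})=\sigma^{m+1}(-\varepsilon_m)^k\,{}_2\varphi_1\Big(-q^{2m-2\gamma-2},-q^{2m-2\gamma};0;q^{-4},-\frac{q^{-4}}{x^2}\Big),\qquad \tilde h_n(x)=x^n\,{}_2\varphi_1\Big(q^{2n-2},q^{2n};0;q^{-4},-\frac{q^{-4}}{x^2}\Big),$$ and put $M_c=\dfrac{(q^{-4},q^{-4},-c^{-1}q^{-2},-cq^{-2};q^{-4})_\infty}{(-c,-c^{-1}q^{-4};q^{-4})_\infty}$.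 Then $\tilde k_m$ and $\tilde h_n$ are real on the lattice, each $\tilde k_m$ solves the eigenvalue equation $$\big(q+q^{-1}-q\,\varepsilon_m x^2\big)g(x)-q^{-1}g(q^2x)-q(1+x^2)\,g(q^{-2}x)=0$$ at every point $x$ of the lattice, and for all $m,n\in\mathbb Z$ $$\sum_{k\in\mathbb Z,\ \sigma=\pm1}\frac{\tilde k_m(\sigma\sqrt c\,q^{-2k})\,\tilde k_n(\sigma\sqrt c\,q^{-2k})}{(-cq^{-4k};q^{-4})_\infty}\,q^{-2k}=2M_c\,\frac{c^mq^{2m^2}}{(-c^{-1}q^{-2m-2};q^{-2})_\infty}\,\delta_{mn},$$ and for all $n\in\mathbb N$, $m\in\mathbb Z$ $$\sum_{k\in\mathbb Z,\ \sigma=\pm1}\frac{\tilde h_n(\sigma\sqrt c\,q^{-2k})\,\tilde k_m(\sigma\sqrt c\,q^{-2k})}{(-cq^{-4k};q^{-4})_\infty}\,q^{-2k}=0,$$ all sums converging absolutely. Moreover, the orthogonality relation for the $\tilde k_m$, with the same norms, also holds if the prefactor $\sigma^{m+1}(-\varepsilon_m)^k$ is replaced by $(-x)^{m-\gamma}\sqrt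 c^{\,\gamma-m}$ (principal value of the power) and the first factor in the sum is complex conjugated. -/

import Mathlib

namespace QOscillator

/-- The finite `q`-shifted factorial `(a;q)_n = ∏_{i<n} (1 - a q^i)`. -/
noncomputable def qPoch {R : Type*} [CommRing R] (a q : R) (n : ℕ) : R :=
  ∏ i ∈ Finset.range n, (1 - a * q ^ i)

/-- The infinite `q`-shifted factorial `(a;q)_∞ = ∏_{i≥0} (1 - a q^i)`, for `|q| < 1`. -/
noncomputable def qPochInf {R : Type*} [CommRing R] [TopologicalSpace R] (a q : R) : R :=
  ∏' i : ℕ, (1 - a * q ^ i)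

/-- `F` is holomorphic on `ℂ \ [1,∞)` and equals there, inside the unit disc, the sum of the basic
hypergeometric series `∑_n (a;q)_n (b;q)_n / ((c;q)_n (q;q)_n) z^n`. -/
def IsPhi21 (a b c q : ℂ) (F : ℂ → ℂ) : Prop :=
  DifferentiableOn ℂ F {z : ℂ | 1 - z ∈ Complex.slitPlane} ∧
    ∀ z : ℂ, ‖z‖ < 1 →
      HasSum (fun n : ℕ => qPoch a q n * qPoch b q n / (qPoch c q n * qPoch q q n) * z ^ n) (F z)

open Classical in
/-- The basic hypergeometric function `₂φ₁(a,b;c;q,z)`: the analytic continuation to `ℂ \ [1,∞)` of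
its defining series.  By the identity theorem, its values on `ℂ \ [1,∞)` do not depend on the
choice of `F`. -/
noncomputable def phi21 (a b c q z : ℂ) : ℂ :=
  if h : ∃ F : ℂ → ℂ, IsPhi21 a b c q F then h.choose z else 0

/-- The constant `c = q^{-2γ}`. -/
noncomputable def cst (q γ : ℝ) : ℝ := q ^ (-2 * γ)

/-- The lattice point `σ √c q^{-2k}`, with `σ = ±1` and `k ∈ ℤ`. -/
noncomputable def pt (q γ : ℝ) (σ : ℤˣ) (k : ℤ) : ℝ :=
  ((σ : ℤ) : ℝ) * √(cst q γ) * q ^ (-2 * k)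

/-- The weight `q^{-2k} / (-c q^{-4k}; q^{-4})_∞`. -/
noncomputable def weight (q γ : ℝ) (k : ℤ) : ℝ :=
  q ^ (-2 * k) / qPochInf (-(cst q γ * q ^ (-4 * k))) (q ^ (-4 : ℤ))

/-- The polynomial part `h̃_n(x) = x^n ₂φ₁(q^{2n-2}, q^{2n}; 0; q^{-4}, -q^{-4}/x²)` of the Fock
eigenfunctions. -/
noncomputable def hTilde (q : ℝ) (n : ℕ) (x : ℝ) : ℂ :=
  ((x ^ n : ℝ) : ℂ) *
    phi21 ((q ^ (2 * (n : ℤ) - 2) : ℝ) : ℂ) ((q ^ (2 * (n : ℤ)) : ℝ) : ℂ) 0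
      ((q ^ (-4 : ℤ) : ℝ) : ℂ) ((-(q ^ (-4 : ℤ) / x ^ 2) : ℝ) : ℂ)

/-- The factor `₂φ₁(-q^{2m-2γ-2}, -q^{2m-2γ}; 0; q^{-4}, -q^{-4}/x²)`. -/
noncomputable def kPhi (q γ : ℝ) (m : ℤ) (x : ℝ) : ℂ :=
  phi21 ((-q ^ (2 * (m : ℝ) - 2 * γ - 2) : ℝ) : ℂ) ((-q ^ (2 * (m : ℝ) - 2 * γ) : ℝ) : ℂ) 0
    ((q ^ (-4 : ℤ) : ℝ) : ℂ) ((-(q ^ (-4 : ℤ) / x ^ 2) : ℝ) : ℂ)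

/-- The spectral parameter `ε = q^{2γ-2m}` of the non-Fock part of the spectrum. -/
noncomputable def eps (q γ : ℝ) (m : ℤ) : ℝ := q ^ (2 * γ - 2 * (m : ℝ))

/-- The non-Fock eigenfunction `k̃_m` at the lattice point `x = σ √c q^{-2k}`: on the positive half
`(-ε)^k ₂φ₁(-1/(εq²), -1/ε; 0; q^{-4}, -q^{-4}/x²)` with `ε = q^{2γ-2m}`, continued to the negative
half as an even function for odd `m` and as an odd function for even `m`. -/
noncomputable def kTilde (q γ : ℝ) (m : ℤ) (σ : ℤˣ) (k : ℤ) : ℂ :=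
  ((((σ ^ (m + 1) : ℤˣ) : ℤ) : ℝ) * (-eps q γ m) ^ k : ℝ) * kPhi q γ m (pt q γ σ k)

/-- The function `(-x)^{m-γ} √c^{γ-m} ₂φ₁(-q^{2m-2γ-2}, -q^{2m-2γ}; 0; q^{-4}, -q^{-4}/x²)` of real
`x ≠ 0`, with the principal value of the complex power `(-x)^{m-γ}`. -/
noncomputable def kPrincipal (q γ : ℝ) (m : ℤ) (x : ℝ) : ℂ :=
  ((-x : ℝ) : ℂ) ^ (((m : ℝ) - γ : ℝ) : ℂ) * ((√(cst q γ) ^ (γ - (m : ℝ)) : ℝ) : ℂ) * kPhi q γ m x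

/-- `M_c = (q^{-4}, q^{-4}, -c^{-1}q^{-2}, -cq^{-2}; q^{-4})_∞ / (-c, -c^{-1}q^{-4}; q^{-4})_∞`. -/
noncomputable def Mc (q γ : ℝ) : ℝ :=
  (qPochInf (q ^ (-4 : ℤ)) (q ^ (-4 : ℤ)) * qPochInf (q ^ (-4 : ℤ)) (q ^ (-4 : ℤ)) *
      qPochInf (-((cst q γ)⁻¹ * q ^ (-2 : ℤ))) (q ^ (-4 : ℤ)) *
      qPochInf (-(cst q γ * q ^ (-2 : ℤ))) (q ^ (-4 : ℤ))) /
    (qPochInf (-cst q γ) (q ^ (-4 : ℤ)) *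
      qPochInf (-((cst q γ)⁻¹ * q ^ (-4 : ℤ))) (q ^ (-4 : ℤ)))

/-- `2 M_c c^m q^{2m²} / (-c^{-1} q^{-2m-2}; q^{-2})_∞`, the squared norm of `k̃_m`. -/
noncomputable def normSq (q γ : ℝ) (m : ℤ) : ℝ :=
  2 * Mc q γ * (cst q γ ^ m * q ^ (2 * m ^ 2)) /
    qPochInf (-((cst q γ)⁻¹ * q ^ (-2 * m - 2))) (q ^ (-2 : ℤ))

end QOscillator

/-!
Put `r = q⁻²` and `p = r²`. On either half `σ = ±1` of the lattice the functions `k̃_m` and `h̃_n`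
are multiples of `f_b(k) = b^{-k} ₂φ₁(br, b; 0; p, -p^{1-k}/c)`, with `b = -c r^{-m}` and
`b = r^{-n}` respectively, and the `q`-difference equation of `₂φ₁` turns into a three-term
recurrence in `k`, which is the eigenvalue equation. Hence the discrete Wronskian of `f_b` and
`f_{b'}` telescopes: the weighted sum of `f_b f_{b'}` over `k`, multiplied by `c (1/b' - 1/b)`, is
the difference of the limits of the Wronskian, which are `0` at `k → -∞` and an explicit `W(b, b')`
at `k → ∞`.

To find `W`, note that `(z;p)_∞ ₂φ₁(br, b; 0; p, z)` is an entire function whose coefficients are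
`ρ_n r^{n(n-1)} (-b)^n` with convergent `ρ_n`; along `z = -p^{1-k}/c`, `k → ∞`, its leading
behaviour is therefore a bilateral theta series, a product by Jacobi's triple product identity. At
`b = -c r^{-m}` and `b = r^{-n}` either the limit of `f_b` or the limit of its difference quotient
vanishes, depending on the parity of `m` or `n`. So `W = 0` for parameters of matching parity, while
otherwise the contributions of `σ = 1` and `σ = -1` cancel. The norms are obtained from the limit
`b' → b` of `W(b, b') / (c (1/b' - 1/b))`.
-/

namespace QOscillator

open Filter Topology PowerSeries

/-! ### Evaluation of power series -/

section Evaluation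

variable {𝕜 : Type*} [NormedField 𝕜] {F G : 𝕜⟦X⟧} {a b z : 𝕜}

/-- Absolute convergence of a power series at a point. -/
def AbsConvAt (F : 𝕜⟦X⟧) (z : 𝕜) : Prop := Summable fun n => ‖coeff n F * z ^ n‖

/-- The sum of a power series at a point. -/
noncomputable def seriesEval (F : 𝕜⟦X⟧) (z : 𝕜) : 𝕜 := ∑' n, coeff n F * z ^ n

/-- The power series `F` converges absolutely at `z`, with sum `a`.  This relation is compatible
with the ring operations, so that identities between power series can be evaluated termwise. -/
def HasEval (F : 𝕜⟦X⟧) (z a : 𝕜) : Prop :=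
  AbsConvAt F z ∧ HasSum (fun n => coeff n F * z ^ n) a

theorem HasEval.seriesEval_eq (h : HasEval F z a) : seriesEval F z = a := h.2.tsum_eq

theorem AbsConvAt.hasEval [CompleteSpace 𝕜] (h : AbsConvAt F z) :
    HasEval F z (seriesEval F z) := ⟨h, (Summable.of_norm h).hasSum⟩

theorem hasEval_C (a z : 𝕜) : HasEval (C a) z a := by
  refine ⟨summable_of_ne_finset_zero (s := {0}) fun n hn => ?_, ?_⟩
  · simp [coeff_C, Finset.mem_singleton.not.mp hn]
  · simpa using hasSum_single (f := fun n => coeff n (C a) * z ^ n) 0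
      fun n hn => by simp [coeff_C, hn]

theorem hasEval_one (z : 𝕜) : HasEval 1 z 1 := by simpa using hasEval_C (1 : 𝕜) z

theorem hasEval_X (z : 𝕜) : HasEval X z z := by
  refine ⟨summable_of_ne_finset_zero (s := {1}) fun n hn => ?_, ?_⟩
  · simp [coeff_X, Finset.mem_singleton.not.mp hn]
  · simpa using hasSum_single (f := fun n => coeff n (X : 𝕜⟦X⟧) * z ^ n) 1
      fun n hn => by simp [coeff_X, hn]

theorem HasEval.add (hF : HasEval F z a) (hG : HasEval G z b) : HasEval (F + G) z (a + b) := by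
  refine ⟨(Summable.add hF.1 hG.1).of_nonneg_of_le (fun _ => norm_nonneg _) fun n => ?_, ?_⟩
  · rw [map_add, add_mul]
    exact norm_add_le _ _
  · simpa only [map_add, add_mul] using hF.2.add hG.2

theorem HasEval.mul (hF : HasEval F z a) (hG : HasEval G z b) : HasEval (F * G) z (a * b) := by
  have hcoeff (n : ℕ) : coeff n (F * G) * z ^ n =
      ∑ k ∈ Finset.range (n + 1), coeff k F * z ^ k * (coeff (n - k) G * z ^ (n - k)) := by
    rw [coeff_mul, Finset.Nat.sum_antidiagonal_eq_sum_range_succ fun i j => coeff i F * coeff j G,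
      Finset.sum_mul]
    refine Finset.sum_congr rfl fun k hk => ?_
    rw [← pow_mul_pow_sub z (Finset.mem_range_succ_iff.mp hk)]
    ring
  constructor
  · simpa only [AbsConvAt, hcoeff] using summable_norm_sum_mul_range_of_summable_norm hF.1 hG.1
  · simpa only [hcoeff, hF.2.tsum_eq, hG.2.tsum_eq] using
      hasSum_sum_range_mul_of_summable_norm' hF.1 hF.2.summable hG.1 hG.2.summable

theorem HasEval.sub (hF : HasEval F z a) (hG : HasEval G z b) : HasEval (F - G) z (a - b) := by
  simpa [sub_eq_add_neg] using hF.add ((hasEval_C (-1) z).mul hG)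

theorem norm_coeff_mul_le (hF : AbsConvAt F 1) {M : ℝ} (hG : ∀ n, ‖coeff n G‖ ≤ M) (n : ℕ) :
    ‖coeff n (F * G)‖ ≤ (∑' i, ‖coeff i F‖) * M := by
  have hF' : Summable fun i => ‖coeff i F‖ := by simpa [AbsConvAt] using hF
  have hM : 0 ≤ M := (norm_nonneg _).trans (hG 0)
  rw [coeff_mul, Finset.Nat.sum_antidiagonal_eq_sum_range_succ fun i j => coeff i F * coeff j G]
  calc _ ≤ ∑ i ∈ Finset.range (n + 1), ‖coeff i F‖ * M := by
        refine norm_sum_le_of_le _ fun i _ => ?_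
        rw [norm_mul]
        gcongr
        exact hG _
    _ ≤ (∑' i, ‖coeff i F‖) * M := by
        rw [← Finset.sum_mul]
        gcongr
        exact hF'.sum_le_tsum _ fun _ _ => norm_nonneg _

theorem tendsto_coeff_mul [CompleteSpace 𝕜] (hF : AbsConvAt F 1)
    (hG : Tendsto (fun n => coeff n G) atTop (𝓝 a)) :
    Tendsto (fun n => coeff n (F * G)) atTop (𝓝 (seriesEval F 1 * a)) := by
  have hF' : Summable fun i => ‖coeff i F‖ := by simpa [AbsConvAt] using hF
  obtain ⟨M, hM⟩ := hG.norm.bddAbove_range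
  have hM' (n : ℕ) : ‖coeff n G‖ ≤ M := hM ⟨n, rfl⟩
  rw [seriesEval, ← tsum_mul_right]
  simp only [one_pow, mul_one]
  refine (tendsto_tsum_of_dominated_convergence (hF'.mul_right M)
    (f := fun n i => if i ∈ Finset.range (n + 1) then coeff i F * coeff (n - i) G else 0)
    (fun i => ?_) (.of_forall fun n i => ?_)).congr fun n => ?_
  · refine ((hG.comp (tendsto_sub_atTop_nat i)).const_mul (coeff i F)).congr' ?_
    filter_upwards [eventually_ge_atTop i] with n hn
    rw [if_pos (Finset.mem_range_succ_iff.mpr hn), Function.comp_apply]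
  · have : 0 ≤ M := (norm_nonneg _).trans (hM' 0)
    split_ifs
    · rw [norm_mul]
      gcongr
      exact hM' _
    · rw [norm_zero]
      positivity
  · rw [coeff_mul, Finset.Nat.sum_antidiagonal_eq_sum_range_succ fun i j => coeff i F * coeff j G,
      tsum_eq_sum (s := Finset.range (n + 1)) fun i hi => if_neg hi]
    exact Finset.sum_congr rfl fun i hi => if_pos hi

theorem HasEval.rescale {w : 𝕜} (h : HasEval F (w * z) a) :
    HasEval (PowerSeries.rescale w F) z a := by
  have hcoeff (n : ℕ) : coeff n (PowerSeries.rescale w F) * z ^ n = coeff n F * (w * z) ^ n := by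
    rw [coeff_rescale, mul_pow]
    ring
  simpa only [HasEval, AbsConvAt, hcoeff] using h

@[simp] theorem seriesEval_zero_right (F : 𝕜⟦X⟧) : seriesEval F 0 = coeff 0 F := by
  simpa [seriesEval] using (hasSum_single (f := fun n => coeff n F * (0 : 𝕜) ^ n) 0
    fun n hn => by simp [hn]).tsum_eq

theorem AbsConvAt.tendsto_seriesEval [CompleteSpace 𝕜] (h : AbsConvAt F z) {u : ℕ → 𝕜}
    (hu : Tendsto u atTop (𝓝 0)) (hz : ∀ n, ‖u n‖ ≤ ‖z‖) :
    Tendsto (fun n => seriesEval F (u n)) atTop (𝓝 (coeff 0 F)) := by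
  rw [← seriesEval_zero_right F]
  refine tendsto_tsum_of_dominated_convergence h (fun k => (hu.pow k).const_mul _) ?_
  filter_upwards with n k
  rw [norm_mul, norm_mul, norm_pow, norm_pow]
  gcongr
  exact hz n

theorem absConvAt_of_coeff_succ_eq_mul {u : ℕ → 𝕜} {l : 𝕜}
    (hF : ∀ n, coeff (n + 1) F = u n * coeff n F) (hu : Tendsto u atTop (𝓝 l))
    (hl : ‖l * z‖ < 1) : AbsConvAt F z := by
  obtain ⟨ρ, hlρ, hρ⟩ := exists_between hl
  refine summable_of_ratio_norm_eventually_le (r := ρ) hρ ?_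
  filter_upwards [((hu.mul_const z).norm).eventually_lt_const hlρ] with n hn
  rw [norm_norm, norm_norm, hF, pow_succ]
  calc ‖u n * coeff n F * (z ^ n * z)‖ = ‖u n * z‖ * ‖coeff n F * z ^ n‖ := by
        rw [← norm_mul]; ring_nf
    _ ≤ ρ * ‖coeff n F * z ^ n‖ := by gcongr

theorem continuous_seriesEval {𝕜 : Type*} [NontriviallyNormedField 𝕜] [CompleteSpace 𝕜]
    {F : 𝕜⟦X⟧} (h : ∀ z, AbsConvAt F z) : Continuous (seriesEval F) := by
  refine continuous_iff_continuousAt.mpr fun z => ?_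
  obtain ⟨w, hw⟩ := NormedField.exists_lt_norm 𝕜 ‖z‖
  refine (continuousOn_tsum (s := Metric.closedBall 0 ‖w‖) (fun n => by fun_prop) (h w)
    fun n x hx => ?_).continuousAt (Metric.closedBall_mem_nhds_of_mem (by simpa using hw))
  rw [norm_mul, norm_mul, norm_pow, norm_pow]
  gcongr
  simpa using hx

theorem differentiable_seriesEval {F : ℂ⟦X⟧} (h : ∀ z, AbsConvAt F z) :
    Differentiable ℂ (seriesEval F) := fun z => by
  obtain ⟨w, hw⟩ := NormedField.exists_lt_norm ℂ ‖z‖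
  refine (Complex.differentiableOn_tsum_of_summable_norm (h w)
    (fun n => (by fun_prop : Differentiable ℂ fun x : ℂ => coeff n F * x ^ n).differentiableOn)
    Metric.isOpen_ball fun n x hx => ?_).differentiableAt
      (Metric.isOpen_ball.mem_nhds (mem_ball_zero_iff.mpr hw))
  rw [norm_mul, norm_mul, norm_pow, norm_pow]
  gcongr
  exact (mem_ball_zero_iff.mp hx).le

theorem ofReal_seriesEval (F : ℝ⟦X⟧) (z : ℝ) :
    ((seriesEval F z : ℝ) : ℂ) = seriesEval (F.map Complex.ofRealHom) (z : ℂ) := by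
  simp [seriesEval, Complex.ofReal_tsum]

end Evaluation

/-! ### `q`-shifted factorials -/

section Pochhammer

variable {R : Type*} [CommRing R]

@[simp] theorem qPoch_zero_right (a p : R) : qPoch a p 0 = 1 := by simp [qPoch]

@[simp] theorem qPoch_zero_left (p : R) (n : ℕ) : qPoch 0 p n = 1 := by simp [qPoch]

theorem qPoch_succ (a p : R) (n : ℕ) : qPoch a p (n + 1) = qPoch a p n * (1 - a * p ^ n) :=
  Finset.prod_range_succ _ _

theorem qPoch_add (a p : R) (m n : ℕ) :
    qPoch a p (m + n) = qPoch a p m * qPoch (a * p ^ m) p n := by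
  simp only [qPoch, Finset.prod_range_add, pow_add, mul_assoc]

theorem qPoch_succ' (a p : R) (n : ℕ) : qPoch a p (n + 1) = (1 - a) * qPoch (a * p) p n := by
  simpa [add_comm, qPoch] using qPoch_add a p 1 n

theorem map_qPoch {S : Type*} [CommRing S] (f : R →+* S) (a p : R) (n : ℕ) :
    f (qPoch a p n) = qPoch (f a) (f p) n := by
  simp [qPoch]

variable {𝕜 : Type*} [NormedField 𝕜] {p : 𝕜}

theorem one_sub_pow_succ_ne_zero (hp : ‖p‖ < 1) (n : ℕ) : 1 - p * p ^ n ≠ 0 := by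
  refine sub_ne_zero.mpr fun h => ?_
  have : ‖p ^ (n + 1)‖ < 1 := by
    rw [norm_pow]; exact pow_lt_one₀ (norm_nonneg _) hp (Nat.succ_ne_zero n)
  simp [pow_succ', ← h] at this

theorem qPoch_self_ne_zero (hp : ‖p‖ < 1) (n : ℕ) : qPoch p p n ≠ 0 :=
  Finset.prod_ne_zero_iff.mpr fun i _ => one_sub_pow_succ_ne_zero hp i

theorem tendsto_pow_mul_zero (hp : ‖p‖ < 1) (z : 𝕜) :
    Tendsto (fun n : ℕ => p ^ n * z) atTop (𝓝 0) := by
  simpa using (tendsto_pow_atTop_nhds_zero_of_norm_lt_one hp).mul_const z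

theorem norm_pow_mul_le (hp : ‖p‖ < 1) (z : 𝕜) (n : ℕ) : ‖p ^ n * z‖ ≤ ‖z‖ := by
  rw [norm_mul, norm_pow]
  exact mul_le_of_le_one_left (norm_nonneg _) (pow_le_one₀ (norm_nonneg _) hp.le)

theorem tendsto_one_sub_mul_pow (hp : ‖p‖ < 1) (a : 𝕜) :
    Tendsto (fun n : ℕ => 1 - a * p ^ n) atTop (𝓝 1) := by
  simpa using ((tendsto_pow_atTop_nhds_zero_of_norm_lt_one hp).const_mul a).const_sub 1

theorem summable_norm_neg_mul_pow (hp : ‖p‖ < 1) (a : 𝕜) :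
    Summable fun i : ℕ => ‖-(a * p ^ i)‖ := by
  simp only [norm_neg, norm_mul, norm_pow]
  exact (summable_geometric_of_lt_one (norm_nonneg _) hp).mul_left _

variable [CompleteSpace 𝕜]

theorem tendsto_qPoch (hp : ‖p‖ < 1) (a : 𝕜) :
    Tendsto (qPoch a p) atTop (𝓝 (qPochInf a p)) := by
  have h : Multipliable fun i : ℕ => 1 - a * p ^ i := by
    simpa [sub_eq_add_neg] using multipliable_one_add_of_summable (summable_norm_neg_mul_pow hp a)
  exact h.hasProd.tendsto_prod_nat

theorem qPochInf_eq_qPoch_mul (hp : ‖p‖ < 1) (a : 𝕜) (n : ℕ) :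
    qPochInf a p = qPoch a p n * qPochInf (a * p ^ n) p := by
  refine tendsto_nhds_unique ((tendsto_add_atTop_iff_nat n).mpr (tendsto_qPoch hp a)) ?_
  refine ((tendsto_qPoch hp (a * p ^ n)).const_mul (qPoch a p n)).congr fun k => ?_
  rw [add_comm k n, qPoch_add]

theorem qPochInf_eq_one_sub_mul (hp : ‖p‖ < 1) (a : 𝕜) :
    qPochInf a p = (1 - a) * qPochInf (a * p) p := by
  simpa [qPoch] using qPochInf_eq_qPoch_mul hp a 1

theorem qPochInf_ne_zero (hp : ‖p‖ < 1) {a : 𝕜} (ha : ∀ n : ℕ, a * p ^ n ≠ 1) :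
    qPochInf a p ≠ 0 := by
  simp only [qPochInf, sub_eq_add_neg]
  refine tprod_one_add_ne_zero_of_summable (fun n => ?_) (summable_norm_neg_mul_pow hp a)
  rw [← sub_eq_add_neg]
  exact sub_ne_zero.mpr (ha n).symm

theorem qPochInf_ne_zero_of_norm_lt_one (hp : ‖p‖ < 1) {a : 𝕜} (ha : ‖a‖ < 1) :
    qPochInf a p ≠ 0 := by
  refine qPochInf_ne_zero hp fun n h => ?_
  have := (norm_pow_mul_le hp a n).trans_lt ha
  rw [mul_comm, h, norm_one] at this
  exact lt_irrefl _ this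

theorem seriesEval_eq_qPochInf_mul (hp : ‖p‖ < 1) {F : 𝕜⟦X⟧}
    (hF : F = (1 - X) * rescale p F) (h : ∀ z, AbsConvAt F z) (z : 𝕜) :
    seriesEval F z = qPochInf z p * coeff 0 F := by
  have step (w : 𝕜) : seriesEval F w = (1 - w) * seriesEval F (p * w) := by
    conv_lhs => rw [hF]
    exact (((hasEval_one w).sub (hasEval_X w)).mul (h (p * w)).hasEval.rescale).seriesEval_eq
  have iterate (n : ℕ) : qPoch z p n * seriesEval F (p ^ n * z) = seriesEval F z := by
    induction n with
    | zero => simp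
    | succ n ih =>
      rw [← ih, step (p ^ n * z), qPoch_succ, pow_succ']
      ring_nf
  have lim := (tendsto_qPoch hp z).mul
    ((h z).tendsto_seriesEval (tendsto_pow_mul_zero hp z) (norm_pow_mul_le hp z))
  exact tendsto_nhds_unique (tendsto_const_nhds.congr fun n => (iterate n).symm) lim

theorem qPochInf_mul_seriesEval_eq (hp : ‖p‖ < 1) {F : 𝕜⟦X⟧}
    (hF : (1 - X) * F = rescale p F) {z : 𝕜} (h : ∀ n : ℕ, AbsConvAt F (p ^ n * z)) :
    qPochInf z p * seriesEval F z = coeff 0 F := by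
  have step (n : ℕ) :
      (1 - p ^ n * z) * seriesEval F (p ^ n * z) = seriesEval F (p ^ (n + 1) * z) := by
    have heval := ((hasEval_one _).sub (hasEval_X _)).mul (h n).hasEval
    rw [hF] at heval
    rw [← heval.seriesEval_eq, pow_succ', mul_assoc]
    refine (HasEval.rescale ?_).seriesEval_eq
    simpa only [pow_succ', mul_assoc] using (h (n + 1)).hasEval
  have iterate (n : ℕ) : qPoch z p n * seriesEval F z = seriesEval F (p ^ n * z) := by
    induction n with
    | zero => simp
    | succ n ih =>
      rw [← step n, ← ih, qPoch_succ]
      ring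
  refine tendsto_nhds_unique ((tendsto_qPoch hp z).mul_const _) ?_
  simp only [iterate]
  exact AbsConvAt.tendsto_seriesEval (by simpa using h 0) (tendsto_pow_mul_zero hp z)
    (norm_pow_mul_le hp z)

theorem ofReal_qPoch (a p : ℝ) (n : ℕ) :
    ((qPoch a p n : ℝ) : ℂ) = qPoch (a : ℂ) (p : ℂ) n := map_qPoch Complex.ofRealHom a p n

theorem ofReal_qPochInf {p : ℝ} (hp : ‖p‖ < 1) (a : ℝ) :
    ((qPochInf a p : ℝ) : ℂ) = qPochInf (a : ℂ) (p : ℂ) := by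
  have hp' : ‖(p : ℂ)‖ < 1 := by rwa [Complex.norm_real]
  refine tendsto_nhds_unique ((Complex.continuous_ofReal.tendsto _).comp (tendsto_qPoch hp a))
    ((tendsto_qPoch hp' (a : ℂ)).congr fun n => ?_)
  exact (ofReal_qPoch a p n).symm

end Pochhammer

/-! ### Basic hypergeometric power series -/

section Series

/-- Euler's series `∑ (-1)^i p^{i(i-1)/2} z^i / (p;p)_i`, the expansion of `(z;p)_∞`. -/
noncomputable def eulerSeries {𝕜 : Type*} [Field 𝕜] (p : 𝕜) : 𝕜⟦X⟧ :=
  mk fun i => (-1) ^ i * p ^ i.choose 2 / qPoch p p i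

/-- The series `∑ (a;p)_n z^n / (p;p)_n` of the `q`-binomial theorem. -/
noncomputable def qBinomialSeries {𝕜 : Type*} [Field 𝕜] (a p : 𝕜) : 𝕜⟦X⟧ :=
  mk fun n => qPoch a p n / qPoch p p n

/-- The series `∑ (a;p)_n (b;p)_n z^n / (p;p)_n` defining `₂φ₁(a,b;0;p,z)`. -/
noncomputable def phiSeries {𝕜 : Type*} [Field 𝕜] (a b p : 𝕜) : 𝕜⟦X⟧ :=
  mk fun n => qPoch a p n * qPoch b p n / qPoch p p n

/-- The power series of the entire function `(z;p)_∞ ₂φ₁(br,b;0;p,z)`, where `p = r²`. -/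
noncomputable def entireSeries {𝕜 : Type*} [Field 𝕜] (r b : 𝕜) : 𝕜⟦X⟧ :=
  eulerSeries (r ^ 2) * phiSeries (b * r) b (r ^ 2)

/-- The generating series of `ρ_n = ∑_{j+i=n} (br;p)_j r^i / ((p;p)_j (p;p)_i)`, where `p = r²`.
The coefficients of `entireSeries r b` are `ρ_n r^{n(n-1)} (-b)^n`. -/
noncomputable def rhoSeries {𝕜 : Type*} [Field 𝕜] (r b : 𝕜) : 𝕜⟦X⟧ :=
  qBinomialSeries (b * r) (r ^ 2) * rescale r (qBinomialSeries 0 (r ^ 2))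

variable {𝕜 : Type*} [NormedField 𝕜] {r p : 𝕜}

theorem norm_sq_lt_one (hr : ‖r‖ < 1) : ‖r ^ 2‖ < 1 := by
  rw [norm_pow]; exact pow_lt_one₀ (norm_nonneg _) hr two_ne_zero

theorem coeff_succ_eulerSeries (hp : ‖p‖ < 1) (i : ℕ) :
    coeff (i + 1) (eulerSeries p) = -p ^ i / (1 - p * p ^ i) * coeff i (eulerSeries p) := by
  have h1 := one_sub_pow_succ_ne_zero hp i
  have h2 := qPoch_self_ne_zero hp i
  simp only [eulerSeries, coeff_mk]
  rw [Nat.choose_succ_succ', Nat.choose_one_right, qPoch_succ, pow_add]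
  field_simp
  ring

theorem coeff_succ_qBinomialSeries (hp : ‖p‖ < 1) (a : 𝕜) (i : ℕ) :
    coeff (i + 1) (qBinomialSeries a p) =
      (1 - a * p ^ i) / (1 - p * p ^ i) * coeff i (qBinomialSeries a p) := by
  have h2 := qPoch_self_ne_zero hp i
  simp only [qBinomialSeries, coeff_mk]
  rw [qPoch_succ, qPoch_succ]
  field_simp

theorem coeff_succ_phiSeries (hp : ‖p‖ < 1) (a b : 𝕜) (i : ℕ) :
    coeff (i + 1) (phiSeries a b p) =
      (1 - a * p ^ i) * (1 - b * p ^ i) / (1 - p * p ^ i) * coeff i (phiSeries a b p) := by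
  have h2 := qPoch_self_ne_zero hp i
  simp only [phiSeries, coeff_mk]
  rw [qPoch_succ, qPoch_succ, qPoch_succ]
  field_simp

theorem absConvAt_eulerSeries (hp : ‖p‖ < 1) (z : 𝕜) : AbsConvAt (eulerSeries p) z := by
  refine absConvAt_of_coeff_succ_eq_mul (l := 0) (coeff_succ_eulerSeries hp) ?_ (by simp)
  simpa [Pi.div_def] using (tendsto_pow_atTop_nhds_zero_of_norm_lt_one hp).neg.div
    (tendsto_one_sub_mul_pow hp p) one_ne_zero

theorem absConvAt_qBinomialSeries (hp : ‖p‖ < 1) (a : 𝕜) {z : 𝕜} (hz : ‖z‖ < 1) :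
    AbsConvAt (qBinomialSeries a p) z := by
  refine absConvAt_of_coeff_succ_eq_mul (l := 1) (coeff_succ_qBinomialSeries hp a) ?_
    (by simpa using hz)
  simpa [Pi.div_def] using
    (tendsto_one_sub_mul_pow hp a).div (tendsto_one_sub_mul_pow hp p) one_ne_zero

theorem absConvAt_phiSeries (hp : ‖p‖ < 1) (a b : 𝕜) {z : 𝕜} (hz : ‖z‖ < 1) :
    AbsConvAt (phiSeries a b p) z := by
  refine absConvAt_of_coeff_succ_eq_mul (l := 1) (coeff_succ_phiSeries hp a b) ?_
    (by simpa using hz)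
  simpa [Pi.div_def] using ((tendsto_one_sub_mul_pow hp a).mul (tendsto_one_sub_mul_pow hp b)).div
    (tendsto_one_sub_mul_pow hp p) one_ne_zero

@[simp] theorem constantCoeff_rescale (a : 𝕜) (F : 𝕜⟦X⟧) :
    constantCoeff (rescale a F) = constantCoeff F := by
  rw [← coeff_zero_eq_constantCoeff_apply, coeff_rescale]
  simp

theorem eulerSeries_eq (hp : ‖p‖ < 1) :
    eulerSeries p = (1 - X) * rescale p (eulerSeries p) := by
  ext n
  cases n with
  | zero => simp [sub_mul]
  | succ n =>
    have h1 := one_sub_pow_succ_ne_zero hp n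
    rw [sub_mul, map_sub, one_mul, coeff_succ_X_mul, coeff_rescale, coeff_rescale,
      coeff_succ_eulerSeries hp, pow_succ']
    linear_combination coeff n (eulerSeries p) * div_mul_cancel₀ (-p ^ n) h1

theorem qBinomialSeries_eq (hp : ‖p‖ < 1) (a : 𝕜) :
    (1 - X) * qBinomialSeries a p = (1 - C a * X) * rescale p (qBinomialSeries a p) := by
  ext n
  cases n with
  | zero => simp [sub_mul, mul_assoc]
  | succ n =>
    have h1 := one_sub_pow_succ_ne_zero hp n
    rw [sub_mul, sub_mul, map_sub, map_sub, one_mul, one_mul, mul_assoc, coeff_C_mul,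
      coeff_succ_X_mul, coeff_succ_X_mul, coeff_rescale, coeff_rescale,
      coeff_succ_qBinomialSeries hp, pow_succ']
    linear_combination coeff n (qBinomialSeries a p) * div_mul_cancel₀ (1 - a * p ^ n) h1

theorem phiSeries_eq (hp : ‖p‖ < 1) (a b : 𝕜) :
    (1 - X) * phiSeries a b p = (1 - C (a + b) * X) * rescale p (phiSeries a b p) +
      C (a * b) * X * rescale p (rescale p (phiSeries a b p)) := by
  ext n
  cases n with
  | zero => simp [sub_mul, mul_assoc]
  | succ n =>
    have h1 := one_sub_pow_succ_ne_zero hp n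
    rw [map_add, sub_mul, sub_mul, map_sub, map_sub, one_mul, one_mul, mul_assoc, mul_assoc,
      coeff_C_mul, coeff_C_mul, coeff_succ_X_mul, coeff_succ_X_mul, coeff_succ_X_mul,
      coeff_rescale, coeff_rescale, coeff_rescale, coeff_rescale, coeff_succ_phiSeries hp,
      pow_succ']
    linear_combination coeff n (phiSeries a b p) *
      div_mul_cancel₀ ((1 - a * p ^ n) * (1 - b * p ^ n)) h1

theorem C_mul_rescale_phiSeries_sub (a b p : 𝕜) :
    C b * rescale p (phiSeries a b p) - phiSeries a b p =
      -(C (1 - b) * phiSeries (b * p) a p) := by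
  ext n
  have h : qPoch b p n * (1 - b * p ^ n) = (1 - b) * qPoch (b * p) p n := by
    rw [← qPoch_succ, qPoch_succ']
  rw [map_sub, map_neg, coeff_C_mul, coeff_C_mul, coeff_rescale]
  simp only [phiSeries, coeff_mk]
  linear_combination (-qPoch a p n / qPoch p p n) * h

theorem entireSeries_eq (hr : ‖r‖ < 1) (b : 𝕜) :
    entireSeries r b = (1 - C (b * r + b) * X) * rescale (r ^ 2) (entireSeries r b) +
      C (b * r * b) * X * (1 - C (r ^ 2) * X) *
        rescale (r ^ 2) (rescale (r ^ 2) (entireSeries r b)) := by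
  have hp := norm_sq_lt_one hr
  have hφ := phiSeries_eq hp (b * r) b
  have hE := eulerSeries_eq hp
  have hE' := congrArg (rescale (r ^ 2)) hE
  rw [map_mul, map_sub, map_one, rescale_X] at hE'
  simp only [entireSeries, map_mul] at hφ hE' ⊢
  linear_combination (phiSeries (b * r) b (r ^ 2)) * hE + rescale (r ^ 2) (eulerSeries (r ^ 2)) * hφ
    + C b * C r * C b * X * rescale (r ^ 2) (rescale (r ^ 2) (phiSeries (b * r) b (r ^ 2))) * hE'

theorem C_mul_rescale_entireSeries_sub (hr : ‖r‖ < 1) (b : 𝕜) :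
    C b * (1 - X) * rescale (r ^ 2) (entireSeries r b) - entireSeries r b =
      -(C (1 - b) * entireSeries r (b * r)) := by
  have hE := eulerSeries_eq (norm_sq_lt_one hr)
  have hφ := C_mul_rescale_phiSeries_sub (b * r) b (r ^ 2)
  rw [show b * r ^ 2 = b * r * r by ring] at hφ
  simp only [entireSeries, map_mul]
  linear_combination (-C b * rescale (r ^ 2) (phiSeries (b * r) b (r ^ 2))) * hE +
    eulerSeries (r ^ 2) * hφ

theorem rhoSeries_eq (hr : ‖r‖ < 1) (b : 𝕜) :
    (1 - X) * (1 - C r * X) * rhoSeries r b =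
      (1 - C (b * r) * X) * rescale (r ^ 2) (rhoSeries r b) := by
  have hp := norm_sq_lt_one hr
  have h1 := qBinomialSeries_eq hp (b * r)
  have h2 : (1 - C r * X) * rescale r (qBinomialSeries 0 (r ^ 2)) =
      rescale (r ^ 2) (rescale r (qBinomialSeries 0 (r ^ 2))) := by
    simpa [rescale_rescale, mul_comm] using congrArg (rescale r) (qBinomialSeries_eq hp (0 : 𝕜))
  simp only [rhoSeries, map_mul] at h1 ⊢
  linear_combination (1 - C r * X) * rescale r (qBinomialSeries 0 (r ^ 2)) * h1 +
    (1 - C b * C r * X) * rescale (r ^ 2) (qBinomialSeries (b * r) (r ^ 2)) * h2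

theorem coeff_zero_entireSeries (r b : 𝕜) : coeff 0 (entireSeries r b) = 1 := by
  simp [entireSeries, eulerSeries, phiSeries]

theorem coeff_zero_rhoSeries (r b : 𝕜) : coeff 0 (rhoSeries r b) = 1 := by
  simp [rhoSeries, qBinomialSeries, coeff_mul]

theorem coeff_succ_rhoSeries (hr : ‖r‖ < 1) (b : 𝕜) (n : ℕ) :
    (1 - (r ^ 2) ^ (n + 1)) * coeff (n + 1) (rhoSeries r b) =
      (1 + r - b * r * (r ^ 2) ^ n) * coeff n (rhoSeries r b) -
        r * coeff n (X * rhoSeries r b) := by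
  have h : rhoSeries r b - X * (C (1 + r) * rhoSeries r b - C r * (X * rhoSeries r b)) =
      rescale (r ^ 2) (rhoSeries r b) - X * (C (b * r) * rescale (r ^ 2) (rhoSeries r b)) := by
    rw [map_add, map_one]
    linear_combination rhoSeries_eq hr b
  replace h := congrArg (coeff (n + 1)) h
  simp only [map_sub, coeff_succ_X_mul, coeff_C_mul, coeff_rescale] at h
  linear_combination h

theorem coeff_succ_entireSeries (hr : ‖r‖ < 1) (b : 𝕜) (n : ℕ) :
    (1 - (r ^ 2) ^ (n + 1)) * coeff (n + 1) (entireSeries r b) =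
      (b * r * b * ((r ^ 2) ^ n) ^ 2 - (b * r + b) * (r ^ 2) ^ n) * coeff n (entireSeries r b) -
        b * r * b * r ^ 2 *
          coeff n (X * rescale (r ^ 2) (rescale (r ^ 2) (entireSeries r b))) := by
  have h : entireSeries r b = rescale (r ^ 2) (entireSeries r b) +
      X * (C (b * r * b) * rescale (r ^ 2) (rescale (r ^ 2) (entireSeries r b)) -
        C (b * r + b) * rescale (r ^ 2) (entireSeries r b) -
        C (b * r * b * r ^ 2) * (X * rescale (r ^ 2) (rescale (r ^ 2) (entireSeries r b)))) := by
    rw [map_mul C (b * r * b)]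
    linear_combination entireSeries_eq hr b
  replace h := congrArg (coeff (n + 1)) h
  rw [map_add, coeff_succ_X_mul] at h
  simp only [map_sub, coeff_C_mul, coeff_rescale] at h
  linear_combination h

theorem succ_mul_pred (n : ℕ) : (n + 1) * (n + 1 - 1) = n * (n - 1) + 2 * n := by
  cases n with
  | zero => rfl
  | succ n => simp only [Nat.add_sub_cancel]; ring

theorem coeff_entireSeries (hr : ‖r‖ < 1) (b : 𝕜) (n : ℕ) :
    coeff n (entireSeries r b) = coeff n (rhoSeries r b) * r ^ (n * (n - 1)) * (-b) ^ n := by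
  have one_sub_ne_zero (n : ℕ) : 1 - (r ^ 2) ^ (n + 1) ≠ 0 := by
    rw [pow_succ']
    exact one_sub_pow_succ_ne_zero (norm_sq_lt_one hr) n
  induction n using Nat.twoStepInduction with
  | zero => simp [-coeff_zero_eq_constantCoeff, coeff_zero_entireSeries, coeff_zero_rhoSeries]
  | one =>
    refine mul_left_cancel₀ (one_sub_ne_zero 0) ?_
    have hρ := coeff_succ_rhoSeries hr b 0
    have hΓ := coeff_succ_entireSeries hr b 0
    rw [coeff_zero_X_mul, coeff_zero_rhoSeries] at hρ
    rw [coeff_zero_X_mul, coeff_zero_entireSeries] at hΓ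
    linear_combination hΓ + b * hρ
  | more n ih ih_succ =>
    refine mul_left_cancel₀ (one_sub_ne_zero (n + 1)) ?_
    have hρ := coeff_succ_rhoSeries hr b (n + 1)
    have hΓ := coeff_succ_entireSeries hr b (n + 1)
    rw [coeff_succ_X_mul] at hρ
    rw [coeff_succ_X_mul, coeff_rescale, coeff_rescale, ih, ih_succ, succ_mul_pred] at hΓ
    rw [succ_mul_pred (n + 1), succ_mul_pred n]
    linear_combination hΓ - r ^ (n * (n - 1) + 2 * n + 2 * (n + 1)) * (-b) ^ (n + 2) * hρ

end Series

/-! ### The entire function `(z;p)_∞ ₂φ₁(br,b;0;p,z)` -/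

section EntireFun

theorem norm_qPoch_le {𝕜 : Type*} [NormedField 𝕜] (a p : 𝕜) (n : ℕ) :
    ‖qPoch a p n‖ ≤ qPoch (-‖a‖) ‖p‖ n := by
  unfold qPoch
  rw [norm_prod]
  refine Finset.prod_le_prod (fun _ _ => norm_nonneg _) fun i _ => ?_
  calc ‖1 - a * p ^ i‖ ≤ ‖(1 : 𝕜)‖ + ‖a * p ^ i‖ := norm_sub_le _ _
    _ = 1 - -‖a‖ * ‖p‖ ^ i := by rw [norm_one, norm_mul, norm_pow]; ring

theorem qPoch_neg_le_qPoch_neg {x y p : ℝ} (hx : 0 ≤ x) (hxy : x ≤ y) (hp : 0 ≤ p) (n : ℕ) :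
    qPoch (-x) p n ≤ qPoch (-y) p n := by
  refine Finset.prod_le_prod (fun i _ => ?_) fun i _ => ?_
  · have := mul_nonneg hx (pow_nonneg hp i)
    linarith
  · have := mul_le_mul_of_nonneg_right hxy (pow_nonneg hp i)
    linarith

theorem summable_pow_mul_pred_mul_pow {ρ : ℝ} (h0 : 0 ≤ ρ) (h1 : ρ < 1) (x : ℝ) :
    Summable fun n : ℕ => ρ ^ (n * (n - 1)) * |x| ^ n := by
  have hρ : ‖ρ ^ 2‖ < 1 := norm_sq_lt_one (by rwa [Real.norm_of_nonneg h0])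
  have h : AbsConvAt (mk fun n => ρ ^ (n * (n - 1)) : ℝ⟦X⟧) |x| := by
    refine absConvAt_of_coeff_succ_eq_mul (u := fun n => (ρ ^ 2) ^ n) (l := 0) (fun n => ?_)
      (tendsto_pow_atTop_nhds_zero_of_norm_lt_one hρ) (by simp)
    simp only [coeff_mk]
    rw [succ_mul_pred]
    ring
  refine Summable.congr h fun n => ?_
  rw [coeff_mk, Real.norm_of_nonneg (by positivity)]

variable {𝕜 : Type*} [NormedField 𝕜] [CompleteSpace 𝕜] {p r : 𝕜}

theorem qPochInf_mul_seriesEval_qBinomialSeries (hp : ‖p‖ < 1) {z : 𝕜} (hz : ‖z‖ < 1) :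
    qPochInf z p * seriesEval (qBinomialSeries 0 p) z = 1 := by
  rw [qPochInf_mul_seriesEval_eq hp]
  · simp [qBinomialSeries]
  · simpa using qBinomialSeries_eq hp (0 : 𝕜)
  · exact fun n => absConvAt_qBinomialSeries hp 0 ((norm_pow_mul_le hp z n).trans_lt hz)

theorem seriesEval_eulerSeries (hp : ‖p‖ < 1) (z : 𝕜) :
    seriesEval (eulerSeries p) z = qPochInf z p := by
  rw [seriesEval_eq_qPochInf_mul hp (eulerSeries_eq hp) (absConvAt_eulerSeries hp)]
  simp [eulerSeries]

theorem exists_norm_coeff_qBinomialSeries_le (hp : ‖p‖ < 1) (β : ℝ) :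
    ∃ M, ∀ a : 𝕜, ‖a‖ ≤ β → ∀ n, ‖coeff n (qBinomialSeries a p)‖ ≤ M := by
  have hp' : ‖‖p‖‖ < 1 := by simpa using hp
  obtain ⟨M, hM⟩ := (tendsto_qPoch hp' (-β)).norm.bddAbove_range
  obtain ⟨N, hN⟩ := ((tendsto_qPoch hp p).inv₀
    (qPochInf_ne_zero_of_norm_lt_one hp hp)).norm.bddAbove_range
  refine ⟨M * N, fun a ha n => ?_⟩
  have hnum : ‖qPoch a p n‖ ≤ M :=
    calc ‖qPoch a p n‖ ≤ qPoch (-‖a‖) ‖p‖ n := norm_qPoch_le a p n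
      _ ≤ qPoch (-β) ‖p‖ n := qPoch_neg_le_qPoch_neg (norm_nonneg a) ha (norm_nonneg p) n
      _ ≤ M := (le_abs_self _).trans (hM ⟨n, rfl⟩)
  rw [qBinomialSeries, coeff_mk, div_eq_mul_inv, norm_mul]
  exact mul_le_mul hnum (hN ⟨n, rfl⟩) (norm_nonneg _) ((norm_nonneg _).trans hnum)

theorem tendsto_coeff_qBinomialSeries (hp : ‖p‖ < 1) (a : 𝕜) :
    Tendsto (fun n => coeff n (qBinomialSeries a p)) atTop
      (𝓝 (qPochInf a p / qPochInf p p)) := by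
  simp only [qBinomialSeries, coeff_mk]
  exact (tendsto_qPoch hp a).div (tendsto_qPoch hp p) (qPochInf_ne_zero_of_norm_lt_one hp hp)

theorem hasEval_rescale_qBinomialSeries (hr : ‖r‖ < 1) :
    HasEval (rescale r (qBinomialSeries 0 (r ^ 2))) 1 (qPochInf r (r ^ 2))⁻¹ := by
  have hp := norm_sq_lt_one hr
  refine HasEval.rescale ?_
  rw [mul_one, ← eq_inv_of_mul_eq_one_right (qPochInf_mul_seriesEval_qBinomialSeries hp hr)]
  exact (absConvAt_qBinomialSeries hp 0 hr).hasEval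

theorem exists_norm_coeff_rhoSeries_le (hr : ‖r‖ < 1) (β : ℝ) :
    ∃ M, ∀ b : 𝕜, ‖b‖ ≤ β → ∀ n, ‖coeff n (rhoSeries r b)‖ ≤ M := by
  obtain ⟨M, hM⟩ := exists_norm_coeff_qBinomialSeries_le (norm_sq_lt_one hr) β
  refine ⟨(∑' i, ‖coeff i (rescale r (qBinomialSeries 0 (r ^ 2)))‖) * M, fun b hb n => ?_⟩
  have hb' : ‖b * r‖ ≤ β := by
    rw [norm_mul]
    exact (mul_le_of_le_one_right (norm_nonneg b) hr.le).trans hb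
  rw [rhoSeries, mul_comm]
  exact norm_coeff_mul_le (hasEval_rescale_qBinomialSeries hr).1 (hM _ hb') n

theorem tendsto_coeff_rhoSeries (hr : ‖r‖ < 1) (b : 𝕜) :
    Tendsto (fun n => coeff n (rhoSeries r b)) atTop
      (𝓝 (qPochInf (b * r) (r ^ 2) / (qPochInf (r ^ 2) (r ^ 2) * qPochInf r (r ^ 2)))) := by
  have hF := hasEval_rescale_qBinomialSeries hr
  have h := tendsto_coeff_mul hF.1 (tendsto_coeff_qBinomialSeries (norm_sq_lt_one hr) (b * r))
  rw [hF.seriesEval_eq, ← div_eq_inv_mul, div_div] at h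
  simpa only [rhoSeries, mul_comm] using h

theorem norm_coeff_entireSeries_mul_pow {𝕜 : Type*} [NormedField 𝕜] {r : 𝕜} (hr : ‖r‖ < 1)
    (b z : 𝕜) (n : ℕ) : ‖coeff n (entireSeries r b) * z ^ n‖ =
      ‖coeff n (rhoSeries r b)‖ * (‖r‖ ^ (n * (n - 1)) * |‖b‖ * ‖z‖| ^ n) := by
  rw [coeff_entireSeries hr, abs_of_nonneg (by positivity)]
  simp only [norm_mul, norm_pow, norm_neg]
  ring

theorem absConvAt_entireSeries (hr : ‖r‖ < 1) (b z : 𝕜) : AbsConvAt (entireSeries r b) z := by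
  obtain ⟨M, hM⟩ := exists_norm_coeff_rhoSeries_le hr ‖b‖
  refine Summable.of_nonneg_of_le (fun _ => norm_nonneg _) (fun n => ?_)
    ((summable_pow_mul_pred_mul_pow (norm_nonneg r) hr (‖b‖ * ‖z‖)).mul_left M)
  rw [norm_coeff_entireSeries_mul_pow hr]
  gcongr
  exact hM b le_rfl n

/-- The entire function `(z;p)_∞ ₂φ₁(br,b;0;p,z)`, where `p = r²`. -/
noncomputable def entireFun {𝕜 : Type*} [NormedField 𝕜] (r b z : 𝕜) : 𝕜 :=
  seriesEval (entireSeries r b) z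

theorem hasEval_entireSeries (hr : ‖r‖ < 1) (b z : 𝕜) :
    HasEval (entireSeries r b) z (entireFun r b z) := (absConvAt_entireSeries hr b z).hasEval

theorem entireFun_eq (hr : ‖r‖ < 1) (b z : 𝕜) :
    entireFun r b z = (1 - (b * r + b) * z) * entireFun r b (r ^ 2 * z) +
      b * r * b * z * (1 - r ^ 2 * z) * entireFun r b (r ^ 2 * (r ^ 2 * z)) := by
  have linear (a : 𝕜) : HasEval (1 - C a * X) z (1 - a * z) :=
    (hasEval_one z).sub ((hasEval_C a z).mul (hasEval_X z))
  have scaled : HasEval (rescale (r ^ 2) (entireSeries r b)) z (entireFun r b (r ^ 2 * z)) :=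
    (hasEval_entireSeries hr b _).rescale
  have scaled_twice : HasEval (rescale (r ^ 2) (rescale (r ^ 2) (entireSeries r b))) z
      (entireFun r b (r ^ 2 * (r ^ 2 * z))) := (hasEval_entireSeries hr b _).rescale.rescale
  have h := ((linear (b * r + b)).mul scaled).add
    ((((hasEval_C (b * r * b) z).mul (hasEval_X z)).mul (linear (r ^ 2))).mul scaled_twice)
  rw [← entireSeries_eq hr] at h
  exact h.seriesEval_eq

theorem mul_entireFun_sub (hr : ‖r‖ < 1) (b z : 𝕜) :
    b * (1 - z) * entireFun r b (r ^ 2 * z) - entireFun r b z =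
      (b - 1) * entireFun r (b * r) z := by
  have scaled : HasEval (rescale (r ^ 2) (entireSeries r b)) z (entireFun r b (r ^ 2 * z)) :=
    (hasEval_entireSeries hr b _).rescale
  have h := (((hasEval_C b z).mul ((hasEval_one z).sub (hasEval_X z))).mul scaled).sub
    (hasEval_entireSeries hr b z)
  rw [C_mul_rescale_entireSeries_sub hr, ← neg_mul, ← map_neg, neg_sub] at h
  exact h.2.unique ((hasEval_C (b - 1) z).mul (hasEval_entireSeries hr (b * r) z)).2

theorem entireFun_eq_qPochInf_mul (hr : ‖r‖ < 1) (b : 𝕜) {z : 𝕜} (hz : ‖z‖ < 1) :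
    entireFun r b z = qPochInf z (r ^ 2) * seriesEval (phiSeries (b * r) b (r ^ 2)) z := by
  have hp := norm_sq_lt_one hr
  rw [← seriesEval_eulerSeries hp]
  exact ((absConvAt_eulerSeries hp z).hasEval.mul
    (absConvAt_phiSeries hp (b * r) b hz).hasEval).seriesEval_eq

theorem entireFun_one_right (hr : ‖r‖ < 1) (z : 𝕜) : entireFun r 1 z = qPochInf z (r ^ 2) := by
  have : phiSeries (1 * r) 1 (r ^ 2) = 1 := by
    ext n
    cases n with
    | zero => simp [phiSeries]
    | succ n => simp [phiSeries, qPoch_succ', coeff_one]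
  rw [entireFun, entireSeries, this, mul_one, seriesEval_eulerSeries (norm_sq_lt_one hr)]

theorem ofReal_entireFun (r b z : ℝ) :
    ((entireFun r b z : ℝ) : ℂ) = entireFun (r : ℂ) (b : ℂ) (z : ℂ) := by
  have hmap : (entireSeries r b).map Complex.ofRealHom = entireSeries (r : ℂ) (b : ℂ) := by
    rw [entireSeries, entireSeries, map_mul]
    congr 1 <;> ext n <;> simp [eulerSeries, phiSeries, ofReal_qPoch]
  rw [entireFun, ofReal_seriesEval, hmap, entireFun]

end EntireFun

/-! ### The analytic continuation of the basic hypergeometric series -/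

section Continuation

theorem isPreconnected_cut : IsPreconnected {z : ℂ | 1 - z ∈ Complex.slitPlane} := by
  have h : {z : ℂ | 1 - z ∈ Complex.slitPlane} = (1 - ·) '' Complex.slitPlane := by
    ext z
    exact ⟨fun hz => ⟨1 - z, hz, by simp⟩, by rintro ⟨w, hw, rfl⟩; simpa using hw⟩
  rw [h]
  exact (Complex.starConvex_one_slitPlane.isPathConnected
    Complex.one_mem_slitPlane).isConnected.isPreconnected.image _ (by fun_prop)

theorem isOpen_cut : IsOpen {z : ℂ | 1 - z ∈ Complex.slitPlane} :=
  Complex.isOpen_slitPlane.preimage (by fun_prop : Continuous fun z : ℂ => 1 - z)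

theorem IsPhi21.eqOn {a b c q : ℂ} {F G : ℂ → ℂ} (hF : IsPhi21 a b c q F)
    (hG : IsPhi21 a b c q G) : Set.EqOn F G {z : ℂ | 1 - z ∈ Complex.slitPlane} := by
  refine AnalyticOnNhd.eqOn_of_preconnected_of_eventuallyEq (𝕜 := ℂ) (z₀ := 0)
    (hF.1.analyticOnNhd isOpen_cut) (hG.1.analyticOnNhd isOpen_cut) isPreconnected_cut
    (by simp) ?_
  filter_upwards [Metric.ball_mem_nhds (0 : ℂ) one_pos] with z hz
  have hz' : ‖z‖ < 1 := by simpa using hz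
  exact (hF.2 z hz').unique (hG.2 z hz')

theorem qPochInf_ne_zero_of_one_sub_mem_slitPlane {p : ℝ} (h0 : 0 < p) (h1 : p < 1) {z : ℂ}
    (hz : 1 - z ∈ Complex.slitPlane) : qPochInf z (p : ℂ) ≠ 0 := by
  refine qPochInf_ne_zero (by rwa [Complex.norm_real, Real.norm_of_nonneg h0.le]) fun n hn => ?_
  have hz' : z = (((p ^ n)⁻¹ : ℝ) : ℂ) := by
    push_cast
    exact eq_inv_of_mul_eq_one_left hn
  have hle : 1 ≤ (p ^ n)⁻¹ := (one_le_inv₀ (by positivity)).mpr (pow_le_one₀ h0.le h1.le)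
  rw [hz', ← Complex.ofReal_one, ← Complex.ofReal_sub, Complex.ofReal_mem_slitPlane] at hz
  linarith

theorem isPhi21_entireFun_div {r : ℝ} (h0 : 0 < r) (h1 : r < 1) (b : ℂ) :
    IsPhi21 (b * r) b 0 ((r : ℂ) ^ 2)
      fun z => entireFun (r : ℂ) b z / qPochInf z ((r : ℂ) ^ 2) := by
  have hr : ‖(r : ℂ)‖ < 1 := by rwa [Complex.norm_real, Real.norm_of_nonneg h0.le]
  have hp := norm_sq_lt_one hr
  refine ⟨?_, fun z hz => ?_⟩
  · refine DifferentiableOn.div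
      (differentiable_seriesEval (absConvAt_entireSeries hr b)).differentiableOn ?_ fun z hz => ?_
    · simp only [← seriesEval_eulerSeries hp]
      exact (differentiable_seriesEval (absConvAt_eulerSeries hp)).differentiableOn
    · rw [← Complex.ofReal_pow]
      exact qPochInf_ne_zero_of_one_sub_mem_slitPlane (by positivity)
        (pow_lt_one₀ h0.le h1 two_ne_zero) hz
  · have hs := (absConvAt_phiSeries hp (b * r) b hz).hasEval.2
    simp only [entireFun_eq_qPochInf_mul hr b hz]
    rw [mul_div_cancel_left₀ _ (qPochInf_ne_zero_of_norm_lt_one hp hz)]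
    simpa [phiSeries] using hs

theorem phi21_eq {r : ℝ} (h0 : 0 < r) (h1 : r < 1) (b : ℂ) {z : ℂ}
    (hz : 1 - z ∈ Complex.slitPlane) : phi21 (b * r) b 0 ((r : ℂ) ^ 2) z =
      entireFun (r : ℂ) b z / qPochInf z ((r : ℂ) ^ 2) := by
  have hF := isPhi21_entireFun_div h0 h1 b
  have h : ∃ F, IsPhi21 (b * r) b 0 ((r : ℂ) ^ 2) F := ⟨_, hF⟩
  rw [phi21, dif_pos h]
  exact h.choose_spec.eqOn hF hz

theorem phi21_ofReal {r : ℝ} (h0 : 0 < r) (h1 : r < 1) (b : ℝ) {z : ℝ} (hz : z < 1) :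
    phi21 ((b * r : ℝ) : ℂ) (b : ℂ) 0 ((r ^ 2 : ℝ) : ℂ) (z : ℂ) =
      ((entireFun r b z / qPochInf z (r ^ 2) : ℝ) : ℂ) := by
  have hr : ‖r‖ < 1 := by rwa [Real.norm_of_nonneg h0.le]
  have hz' : (1 : ℂ) - z ∈ Complex.slitPlane := by
    rw [← Complex.ofReal_one, ← Complex.ofReal_sub, Complex.ofReal_mem_slitPlane]
    linarith
  rw [Complex.ofReal_div, ofReal_entireFun, ofReal_qPochInf (norm_sq_lt_one hr)]
  push_cast
  exact phi21_eq h0 h1 (b : ℂ) hz'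

end Continuation

/-! ### The eigenfunctions on the lattice -/

section Lattice

/-- The point `-p^{1-k}/c`, `p = r²`, at which the hypergeometric function is evaluated. -/
noncomputable def node (r c : ℝ) (k : ℤ) : ℝ := -(r ^ (2 * (1 - k)) / c)

/-- The sequence `b^{-k} ₂φ₁(br, b; 0; r², -r^{2-2k}/c)` solving the eigenvalue equation. -/
noncomputable def latticeFun (r c b : ℝ) (k : ℤ) : ℝ :=
  b ^ (-k) * (entireFun r b (node r c k) / qPochInf (node r c k) (r ^ 2))

variable {r : ℝ}

theorem norm_lt_one_of_pos (h0 : 0 < r) (h1 : r < 1) : ‖r‖ < 1 := by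
  rwa [Real.norm_of_nonneg h0.le]

theorem node_succ (h0 : 0 < r) (c : ℝ) (k : ℤ) : r ^ 2 * node r c (k + 1) = node r c k := by
  have : r ^ (2 * (1 - k)) = r ^ 2 * r ^ (2 * (1 - (k + 1))) := by
    rw [← zpow_natCast, ← zpow_add₀ h0.ne']
    congr 1
    push_cast
    ring
  rw [node, node, this]
  ring

theorem node_succ_eq (r c : ℝ) (k : ℤ) : node r c (k + 1) = -(c * r ^ (2 * k))⁻¹ := by
  rw [node, show 2 * (1 - (k + 1)) = -(2 * k) by ring, zpow_neg, mul_inv, div_eq_mul_inv, mul_comm]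

theorem node_neg (h0 : 0 < r) {c : ℝ} (hc : 0 < c) (k : ℤ) : node r c k < 0 :=
  neg_neg_of_pos (div_pos (zpow_pos h0 _) hc)

theorem qPochInf_node_succ (h0 : 0 < r) (h1 : r < 1) (c : ℝ) (k : ℤ) :
    qPochInf (node r c (k + 1)) (r ^ 2) =
      (1 - node r c (k + 1)) * qPochInf (node r c k) (r ^ 2) := by
  rw [qPochInf_eq_one_sub_mul (norm_sq_lt_one (norm_lt_one_of_pos h0 h1)), ← node_succ h0 c k,
    mul_comm (r ^ 2)]

theorem one_le_qPoch {x p : ℝ} (hx : 0 ≤ x) (hp : 0 ≤ p) (n : ℕ) : 1 ≤ qPoch (-x) p n := by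
  simpa using qPoch_neg_le_qPoch_neg le_rfl hx hp n

theorem one_le_qPochInf {x p : ℝ} (hx : 0 ≤ x) (hp : 0 ≤ p) (hp1 : p < 1) :
    1 ≤ qPochInf (-x) p :=
  ge_of_tendsto' (tendsto_qPoch (by rwa [Real.norm_of_nonneg hp]) (-x)) (one_le_qPoch hx hp)

theorem one_le_qPochInf_node (h0 : 0 < r) (h1 : r < 1) {c : ℝ} (hc : 0 < c) (k : ℤ) :
    1 ≤ qPochInf (node r c k) (r ^ 2) :=
  one_le_qPochInf (div_pos (zpow_pos h0 _) hc).le (by positivity) (by nlinarith)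

theorem latticeFun_sub_succ (h0 : 0 < r) (h1 : r < 1) {c : ℝ} (hc : 0 < c) {b : ℝ} (hb : b ≠ 0)
    (k : ℤ) : latticeFun r c b k - latticeFun r c b (k + 1) =
      (b - 1) * r ^ (k + 1) * latticeFun r c (b * r) (k + 1) := by
  have hΓ := mul_entireFun_sub (norm_lt_one_of_pos h0 h1) b (node r c (k + 1))
  rw [node_succ h0] at hΓ
  have hpow : b ^ (-k) = b ^ (-(k + 1)) * b := by
    rw [← zpow_add_one₀ hb, neg_add, neg_add_cancel_right]
  have hz : 1 - node r c (k + 1) ≠ 0 := by linarith [node_neg h0 hc (k + 1)]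
  have hQ : qPochInf (node r c k) (r ^ 2) ≠ 0 := by linarith [one_le_qPochInf_node h0 h1 hc k]
  simp only [latticeFun]
  rw [qPochInf_node_succ h0 h1, hpow, mul_zpow, zpow_neg r]
  field_simp
  linear_combination hΓ

theorem latticeFun_recurrence (h0 : 0 < r) (h1 : r < 1) {c : ℝ} (hc : 0 < c) {b : ℝ} (hb : b ≠ 0)
    (k : ℤ) : (1 + r + c * r ^ (2 * k) / b) * latticeFun r c b k =
      r * latticeFun r c b (k - 1) + (1 + c * r ^ (2 * k)) * latticeFun r c b (k + 1) := by
  have hΓ := entireFun_eq (norm_lt_one_of_pos h0 h1) b (node r c (k + 1))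
  have hQsucc := qPochInf_node_succ h0 h1 c (k - 1)
  have hnode := node_succ h0 c (k - 1)
  rw [sub_add_cancel] at hQsucc hnode
  rw [node_succ h0, hnode] at hΓ
  have hcoef : c * r ^ (2 * k) = -(node r c (k + 1))⁻¹ := by
    rw [node_succ_eq, inv_neg, inv_inv, neg_neg]
  have hpow : b ^ (-k) = b ^ (-(k + 1)) * b := by
    rw [← zpow_add_one₀ hb, neg_add, neg_add_cancel_right]
  have hpow' : b ^ (-(k - 1)) = b ^ (-(k + 1)) * b * b := by
    rw [← zpow_add_one₀ hb, ← zpow_add_one₀ hb]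
    congr 1
    ring
  have hz : node r c (k + 1) < 0 := node_neg h0 hc _
  have hz1 : 1 - node r c (k + 1) ≠ 0 := by linarith
  have hw1 : 1 - node r c k ≠ 0 := by linarith [node_neg h0 hc k]
  have hQ : qPochInf (node r c (k - 1)) (r ^ 2) ≠ 0 := by
    linarith [one_le_qPochInf_node h0 h1 hc (k - 1)]
  simp only [latticeFun]
  rw [qPochInf_node_succ h0 h1, hQsucc, hcoef, hpow, hpow']
  field_simp [hz.ne]
  linear_combination (1 - node r c (k + 1)) * hΓ

end Lattice

/-! ### Behaviour of the eigenfunctions near the origin -/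

section Asymptotics

/-- The bilateral theta series `∑_j r^{j(j-1)} t^j`. -/
noncomputable def thetaSum (r t : ℝ) : ℝ := ∑' j : ℤ, r ^ (j * (j - 1)) * t ^ j

/-- The modified theta function `(x;p)_∞ (p/x;p)_∞`. -/
noncomputable def qTheta (p x : ℝ) : ℝ := qPochInf x p * qPochInf (p / x) p

/-- The coefficients of `rhoSeries`, extended by zero to negative indices. -/
noncomputable def rhoInt (r b : ℝ) (j : ℤ) : ℝ :=
  if 0 ≤ j then coeff j.toNat (rhoSeries r b) else 0

/-- The limit of `latticeFun r c b k` as `k → ∞`, that is, as the lattice point tends to `0`. -/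
noncomputable def valueLim (r c b : ℝ) : ℝ :=
  qPochInf (b * r) (r ^ 2) / qPochInf r (r ^ 2) *
    (qTheta (r ^ 2) (-(b * (r ^ 2 / c))) / qTheta (r ^ 2) (-c))

variable {r : ℝ}

theorem zpow_mul_pred (x : ℝ) (n : ℕ) : x ^ ((n : ℤ) * ((n : ℤ) - 1)) = x ^ (n * (n - 1)) := by
  rw [← zpow_natCast]
  congr 1
  cases n with
  | zero => simp
  | succ n => push_cast; simp

theorem summable_theta (h0 : 0 < r) (h1 : r < 1) (t : ℝ) :
    Summable fun j : ℤ => r ^ (j * (j - 1)) * |t| ^ j := by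
  refine Summable.of_nat_of_neg ?_ ?_
  · refine (summable_pow_mul_pred_mul_pow h0.le h1 t).congr fun n => ?_
    rw [zpow_mul_pred, zpow_natCast]
  · refine (summable_pow_mul_pred_mul_pow h0.le h1 (r ^ 2 * t⁻¹)).congr fun n => ?_
    have hexp : -(n : ℤ) * (-(n : ℤ) - 1) = n * (n - 1) + 2 * n := by ring
    rw [hexp, zpow_add₀ h0.ne', zpow_mul_pred, zpow_mul, zpow_natCast, zpow_neg, zpow_natCast,
      abs_mul, abs_inv, mul_pow, inv_pow, abs_of_pos (pow_pos h0 2), mul_assoc]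
    norm_cast

theorem zpow_mul_pow_mul_node_pow (h0 : 0 < r) {b c : ℝ} (hb : b ≠ 0) (hc : c ≠ 0) (k s : ℕ) :
    (b * (r ^ 2 / c)) ^ (-(k : ℤ)) * r ^ (k * (k + 1)) *
        (r ^ (s * (s - 1)) * (-b * node r c k) ^ s) =
      r ^ (((s : ℤ) - k) * ((s : ℤ) - k - 1)) * (b * (r ^ 2 / c)) ^ ((s : ℤ) - k) := by
  have hnode : -b * node r c k = r ^ (-2 * (k : ℤ)) * (b * (r ^ 2 / c)) := by
    rw [node, show 2 * (1 - (k : ℤ)) = -2 * (k : ℤ) + (2 : ℕ) by push_cast; ring,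
      zpow_add₀ h0.ne', zpow_natCast]
    ring
  have hexp : ((s : ℤ) - k) * ((s : ℤ) - k - 1) =
      k * (k + 1) + s * (s - 1) + -2 * k * s := by ring
  have ht : b * (r ^ 2 / c) ≠ 0 := mul_ne_zero hb (div_ne_zero (pow_ne_zero 2 h0.ne') hc)
  rw [hnode, mul_pow, hexp, zpow_add₀ h0.ne', zpow_add₀ h0.ne', zpow_mul_pred, zpow_sub₀ ht,
    zpow_mul _ (-2 * (k : ℤ)), zpow_natCast, zpow_natCast, zpow_neg, zpow_natCast]
  norm_cast
  ring

theorem zpow_mul_pow_mul_entireFun_node (h0 : 0 < r) (h1 : r < 1) {b c : ℝ} (hb : b ≠ 0)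
    (hc : c ≠ 0) (k : ℕ) :
    (b * (r ^ 2 / c)) ^ (-(k : ℤ)) * r ^ (k * (k + 1)) * entireFun r b (node r c k) =
      ∑' j : ℤ, rhoInt r b (j + k) * (r ^ (j * (j - 1)) * (b * (r ^ 2 / c)) ^ j) := by
  have hinj : Function.Injective fun s : ℕ => (s : ℤ) - k := fun a b hab => by
    simpa using hab
  rw [entireFun, seriesEval, ← tsum_mul_left, ← hinj.tsum_eq]
  · refine tsum_congr fun s => ?_
    rw [← zpow_mul_pow_mul_node_pow h0 hb hc k s, coeff_entireSeries (norm_lt_one_of_pos h0 h1),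
      rhoInt, if_pos (by simp)]
    simp only [sub_add_cancel, Int.toNat_natCast]
    rw [mul_pow]
    ring
  · intro j hj
    by_contra hcon
    have : ¬ 0 ≤ j + k := fun hle => hcon ⟨(j + k).toNat, by simp [Int.toNat_of_nonneg hle]⟩
    exact hj (by simp [rhoInt, this])

theorem exists_abs_rhoInt_le (h0 : 0 < r) (h1 : r < 1) (β : ℝ) :
    ∃ M, 0 ≤ M ∧ ∀ b : ℝ, |b| ≤ β → ∀ j, |rhoInt r b j| ≤ M := by
  obtain ⟨M, hM⟩ := exists_norm_coeff_rhoSeries_le (norm_lt_one_of_pos h0 h1) β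
  refine ⟨|M|, abs_nonneg M, fun b hb j => ?_⟩
  rw [rhoInt]
  split_ifs
  · exact (hM b hb _).trans (le_abs_self M)
  · simp

theorem tendsto_rhoInt_add (h0 : 0 < r) (h1 : r < 1) (b : ℝ) (j : ℤ) :
    Tendsto (fun k : ℕ => rhoInt r b (j + k)) atTop
      (𝓝 (qPochInf (b * r) (r ^ 2) / (qPochInf (r ^ 2) (r ^ 2) * qPochInf r (r ^ 2)))) := by
  have hk : Tendsto (fun k : ℕ => (j + k).toNat) atTop atTop :=
    tendsto_atTop.mpr fun n => by
      filter_upwards [eventually_ge_atTop (n + j.natAbs)] with k hk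
      omega
  refine ((tendsto_coeff_rhoSeries (norm_lt_one_of_pos h0 h1) b).comp hk).congr' ?_
  filter_upwards [eventually_ge_atTop j.natAbs] with k hk
  rw [rhoInt, if_pos (by omega)]
  rfl

theorem tendsto_zpow_mul_pow_mul_entireFun_node (h0 : 0 < r) (h1 : r < 1) {b c : ℝ} (hb : b ≠ 0)
    (hc : c ≠ 0) :
    Tendsto (fun k : ℕ =>
      (b * (r ^ 2 / c)) ^ (-(k : ℤ)) * r ^ (k * (k + 1)) * entireFun r b (node r c k)) atTop
      (𝓝 (qPochInf (b * r) (r ^ 2) / (qPochInf (r ^ 2) (r ^ 2) * qPochInf r (r ^ 2)) *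
        thetaSum r (b * (r ^ 2 / c)))) := by
  obtain ⟨M, -, hM⟩ := exists_abs_rhoInt_le h0 h1 |b|
  simp only [zpow_mul_pow_mul_entireFun_node h0 h1 hb hc]
  rw [thetaSum, ← tsum_mul_left]
  refine tendsto_tsum_of_dominated_convergence
    ((summable_theta h0 h1 (b * (r ^ 2 / c))).mul_left M)
    (fun j => (tendsto_rhoInt_add h0 h1 b j).mul_const _) (.of_forall fun k j => ?_)
  rw [norm_mul, norm_mul, norm_zpow, norm_zpow, Real.norm_of_nonneg h0.le, Real.norm_eq_abs,
    Real.norm_eq_abs]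
  gcongr
  exact hM b le_rfl _

theorem zpow_mul_pow_mul_qPochInf_node (h0 : 0 < r) (h1 : r < 1) {c : ℝ} (hc : c ≠ 0) (k : ℕ) :
    (r ^ 2 / c) ^ (-(k : ℤ)) * r ^ (k * (k + 1)) * qPochInf (node r c k) (r ^ 2) =
      qPoch (-c) (r ^ 2) k * qPochInf (-(r ^ 2 / c)) (r ^ 2) := by
  have hr : r ≠ 0 := h0.ne'
  induction k with
  | zero => simp [node]
  | succ k ih =>
    have hpow : r ^ ((k + 1) * (k + 1 + 1)) = r ^ (k * (k + 1)) * (r ^ 2 * (r ^ 2) ^ k) := by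
      ring
    have hzpow : (r ^ 2 / c) ^ (-((k + 1 : ℕ) : ℤ)) =
        (r ^ 2 / c) ^ (-(k : ℤ)) * (r ^ 2 / c)⁻¹ := by
      rw [← zpow_sub_one₀ (div_ne_zero (pow_ne_zero 2 hr) hc)]
      congr 1
      push_cast
      ring
    have hnode : node r c ((k : ℤ) + 1) = -(c * (r ^ 2) ^ k)⁻¹ := by
      rw [node_succ_eq, zpow_mul, zpow_natCast]
      norm_cast
    have hfactor : (r ^ 2 / c)⁻¹ * (r ^ 2 * (r ^ 2) ^ k) * (1 - node r c ((k : ℤ) + 1)) =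
        1 - -c * (r ^ 2) ^ k := by
      rw [hnode]
      field_simp
      ring
    rw [hpow, hzpow, Nat.cast_succ, qPochInf_node_succ h0 h1, qPoch_succ]
    linear_combination (1 - -c * (r ^ 2) ^ k) * ih + (r ^ 2 / c) ^ (-(k : ℤ)) * r ^ (k * (k + 1)) *
      qPochInf (node r c k) (r ^ 2) * hfactor

/-- The identity follows by comparing two limits: for `b = 1` the entire function is `(z;p)_∞`. -/
theorem thetaSum_eq_jacobi_triple_product (h0 : 0 < r) (h1 : r < 1) {t : ℝ} (ht : t ≠ 0) :
    thetaSum r t = qPochInf (r ^ 2) (r ^ 2) * qTheta (r ^ 2) (-t) := by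
  have hr := norm_lt_one_of_pos h0 h1
  have hp := norm_sq_lt_one hr
  have hc : r ^ 2 / t ≠ 0 := div_ne_zero (pow_ne_zero 2 h0.ne') ht
  have ht' : r ^ 2 / (r ^ 2 / t) = t := by field_simp
  have hnode (k : ℕ) : t ^ (-(k : ℤ)) * r ^ (k * (k + 1)) *
      qPochInf (node r (r ^ 2 / t) k) (r ^ 2) =
        qPoch (-(r ^ 2 / t)) (r ^ 2) k * qPochInf (-t) (r ^ 2) := by
    simpa only [ht'] using zpow_mul_pow_mul_qPochInf_node h0 h1 hc k
  have h := tendsto_zpow_mul_pow_mul_entireFun_node h0 h1 one_ne_zero hc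
  simp only [one_mul, entireFun_one_right hr, ht', hnode] at h
  have hlim := tendsto_nhds_unique h ((tendsto_qPoch hp _).mul_const _)
  have hp0 := qPochInf_ne_zero_of_norm_lt_one hp hp
  have hr0 := qPochInf_ne_zero_of_norm_lt_one hp hr
  rw [qTheta, div_neg]
  field_simp at hlim
  linear_combination hlim

theorem qTheta_neg_pos {p : ℝ} (h0 : 0 < p) (h1 : p < 1) {x : ℝ} (hx : 0 < x) :
    0 < qTheta p (-x) := by
  rw [qTheta, div_neg]
  exact mul_pos (one_pos.trans_le (one_le_qPochInf hx.le h0.le h1))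
    (one_pos.trans_le (one_le_qPochInf (div_pos h0 hx).le h0.le h1))

theorem latticeFun_natCast (h0 : 0 < r) (h1 : r < 1) {c : ℝ} (hc : 0 < c) (b : ℝ) (k : ℕ) :
    latticeFun r c b k =
      ((b * (r ^ 2 / c)) ^ (-(k : ℤ)) * r ^ (k * (k + 1)) * entireFun r b (node r c k)) /
        (qPoch (-c) (r ^ 2) k * qPochInf (-(r ^ 2 / c)) (r ^ 2)) := by
  have hzpow : (r ^ 2 / c) ^ (-(k : ℤ)) ≠ 0 := by positivity
  have hpow : r ^ (k * (k + 1)) ≠ 0 := by positivity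
  have hQ : qPochInf (node r c k) (r ^ 2) ≠ 0 := by linarith [one_le_qPochInf_node h0 h1 hc k]
  rw [← zpow_mul_pow_mul_qPochInf_node h0 h1 hc.ne', mul_zpow, latticeFun]
  field_simp

theorem tendsto_latticeFun (h0 : 0 < r) (h1 : r < 1) {c : ℝ} (hc : 0 < c) {b : ℝ} (hb : b ≠ 0) :
    Tendsto (fun k : ℕ => latticeFun r c b k) atTop (𝓝 (valueLim r c b)) := by
  have hr := norm_lt_one_of_pos h0 h1
  have hp := norm_sq_lt_one hr
  have ht : b * (r ^ 2 / c) ≠ 0 := mul_ne_zero hb (by positivity)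
  have hθ := (qTheta_neg_pos (pow_pos h0 2) (pow_lt_one₀ h0.le h1 two_ne_zero) hc).ne'
  have hval : valueLim r c b = qPochInf (b * r) (r ^ 2) /
      (qPochInf (r ^ 2) (r ^ 2) * qPochInf r (r ^ 2)) * thetaSum r (b * (r ^ 2 / c)) /
        (qPochInf (-c) (r ^ 2) * qPochInf (-(r ^ 2 / c)) (r ^ 2)) := by
    have hp0 := qPochInf_ne_zero_of_norm_lt_one hp hp
    rw [thetaSum_eq_jacobi_triple_product h0 h1 ht, valueLim, qTheta.eq_1 _ (-c), div_neg]
    field_simp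
  rw [hval]
  simp only [latticeFun_natCast h0 h1 hc b]
  rw [qTheta, div_neg] at hθ
  exact (tendsto_zpow_mul_pow_mul_entireFun_node h0 h1 hb hc.ne').div
    ((tendsto_qPoch hp (-c)).mul_const _) hθ

end Asymptotics

/-! ### Summation of products of eigenfunctions -/

section Summation

theorem hasSum_sub_of_tendsto {E : Type*} [NormedAddCommGroup E] [CompleteSpace E] {f : ℤ → E}
    {a b : E}
    (hs : Summable fun k => f (k + 1) - f k)
    (ha : Tendsto (fun n : ℕ => f n) atTop (𝓝 a))
    (hb : Tendsto (fun n : ℕ => f (-n)) atTop (𝓝 b)) :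
    HasSum (fun k => f (k + 1) - f k) (a - b) := by
  have hinj : Function.Injective fun n : ℕ => -((n : ℤ) + 1) := fun m n h => by simpa using h
  have hpos : HasSum (fun n : ℕ => f ((n : ℤ) + 1) - f n) (a - f 0) := by
    refine ((hs.comp_injective Nat.cast_injective).hasSum_iff_tendsto_nat).mpr
      ((ha.sub_const _).congr fun N => ?_)
    simpa using (Finset.sum_range_sub (fun n : ℕ => f n) N).symm
  have hneg : HasSum (fun n : ℕ => f (-((n : ℤ) + 1) + 1) - f (-((n : ℤ) + 1))) (f 0 - b) := by
    refine ((hs.comp_injective hinj).hasSum_iff_tendsto_nat).mpr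
      ((hb.const_sub _).congr fun N => ?_)
    simpa using (Finset.sum_range_sub' (fun n : ℕ => f (-n)) N).symm
  simpa using hpos.of_nat_of_neg_add_one (f := fun k => f (k + 1) - f k) hneg

/-- The weight `r^k / (-c r^{2k}; r²)_∞` of the orthogonality relations. -/
noncomputable def latticeWeight (r c : ℝ) (k : ℤ) : ℝ :=
  r ^ k / qPochInf (-(c * r ^ (2 * k))) (r ^ 2)

/-- The limit as `k → ∞` of the difference quotient
`(latticeFun r c b k - latticeFun r c b (k + 1)) / r ^ (k + 1)`. -/
noncomputable def slopeLim (r c b : ℝ) : ℝ := (b - 1) * valueLim r c (b * r)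

/-- The discrete Wronskian of two eigenfunctions, written in terms of difference quotients. Its
differences are the weighted products of the eigenfunctions, times `c (1/b' - 1/b)`. -/
noncomputable def wronskian (r c b b' : ℝ) (k : ℤ) : ℝ :=
  r * ((b - 1) * (latticeFun r c (b * r) k * latticeFun r c b' k) -
    (b' - 1) * (latticeFun r c b k * latticeFun r c (b' * r) k)) /
      qPochInf (-(c * r ^ (2 * k))) (r ^ 2)

/-- The limit of `wronskian r c b b' k` as `k → ∞`. -/
noncomputable def wronskianLim (r c b b' : ℝ) : ℝ :=
  r * (slopeLim r c b * valueLim r c b' - valueLim r c b * slopeLim r c b')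

variable {r : ℝ}

theorem one_le_qPochInf_weight (h0 : 0 < r) (h1 : r < 1) {c : ℝ} (hc : 0 < c) (k : ℤ) :
    1 ≤ qPochInf (-(c * r ^ (2 * k))) (r ^ 2) :=
  one_le_qPochInf (mul_pos hc (zpow_pos h0 _)).le (by positivity) (by nlinarith)

theorem latticeWeight_nonneg (h0 : 0 < r) (h1 : r < 1) {c : ℝ} (hc : 0 < c) (k : ℤ) :
    0 ≤ latticeWeight r c k :=
  div_nonneg (zpow_pos h0 k).le (zero_le_one.trans (one_le_qPochInf_weight h0 h1 hc k))

theorem latticeWeight_natCast_le (h0 : 0 < r) (h1 : r < 1) {c : ℝ} (hc : 0 < c) (n : ℕ) :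
    latticeWeight r c n ≤ r ^ n := by
  rw [latticeWeight, zpow_natCast]
  exact div_le_self (by positivity) (one_le_qPochInf_weight h0 h1 hc n)

theorem latticeWeight_neg_natCast_le (h0 : 0 < r) (h1 : r < 1) {c : ℝ} (hc : 0 < c) (n : ℕ) :
    latticeWeight r c (-n) ≤ r ^ (n * (n - 1)) * (r / c) ^ n := by
  have hnode : node r (r ^ 2 / c) n = -(c * r ^ (2 * -(n : ℤ))) := by
    rw [node, show 2 * (1 - (n : ℤ)) = 2 * -(n : ℤ) + (2 : ℕ) by push_cast; ring,
      zpow_add₀ h0.ne', zpow_natCast]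
    field_simp
  have h := zpow_mul_pow_mul_qPochInf_node h0 h1 (c := r ^ 2 / c) (by positivity) n
  rw [hnode, show r ^ 2 / (r ^ 2 / c) = c by field_simp] at h
  have hle : 1 ≤ c ^ (-(n : ℤ)) * r ^ (n * (n + 1)) *
      qPochInf (-(c * r ^ (2 * -(n : ℤ)))) (r ^ 2) := by
    rw [h]
    exact one_le_mul_of_one_le_of_one_le (one_le_qPoch (by positivity) (by positivity) n)
      (one_le_qPochInf hc.le (by positivity) (by nlinarith))
  have hexp : n * (n + 1) = n + n * (n - 1) + n := by
    cases n with
    | zero => rfl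
    | succ n => simp only [Nat.add_sub_cancel]; ring
  have hpow : r ^ n * (r ^ (n * (n - 1)) * (r / c) ^ n) = c ^ (-(n : ℤ)) * r ^ (n * (n + 1)) := by
    rw [zpow_neg, zpow_natCast, div_pow, hexp, pow_add, pow_add]
    field_simp
  rw [latticeWeight, div_le_iff₀ (one_pos.trans_le (one_le_qPochInf_weight h0 h1 hc _)), zpow_neg,
    zpow_natCast, inv_le_iff_one_le_mul₀ (by positivity)]
  linear_combination hle - qPochInf (-(c * r ^ (2 * -(n : ℤ)))) (r ^ 2) * hpow

theorem zpow_le_zpow_add_zpow {x y z : ℝ} (hx : 0 < x) (hy : y ∈ Set.Icc x z) (j : ℤ) :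
    y ^ j ≤ x ^ j + z ^ j := by
  have hy0 : 0 < y := hx.trans_le hy.1
  have hz0 : 0 < z := hy0.trans_le hy.2
  rcases le_total 0 j with hj | hj
  · exact (zpow_le_zpow_left₀ hj hy0.le hy.2).trans (le_add_of_nonneg_left (zpow_pos hx j).le)
  · obtain ⟨n, rfl⟩ := Int.exists_eq_neg_ofNat hj
    refine le_trans ?_ (le_add_of_nonneg_right (zpow_pos hz0 _).le)
    rw [zpow_neg, zpow_neg, zpow_natCast, zpow_natCast]
    exact inv_anti₀ (pow_pos hx n) (pow_le_pow_left₀ hx.le hy.1 n)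

theorem abs_latticeFun_natCast_le (h0 : 0 < r) (h1 : r < 1) {c : ℝ} (hc : 0 < c) {b : ℝ}
    (hb : b ≠ 0) (k : ℕ) : |latticeFun r c b k| ≤
      |∑' j : ℤ, rhoInt r b (j + k) * (r ^ (j * (j - 1)) * (b * (r ^ 2 / c)) ^ j)| := by
  rw [latticeFun_natCast h0 h1 hc, zpow_mul_pow_mul_entireFun_node h0 h1 hb hc.ne', abs_div]
  refine div_le_self (abs_nonneg _) ((one_le_mul_of_one_le_of_one_le ?_ ?_).trans (le_abs_self _))
  · exact one_le_qPoch hc.le (by positivity) k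
  · exact one_le_qPochInf (by positivity) (by positivity) (by nlinarith)

theorem exists_abs_latticeFun_natCast_le (h0 : 0 < r) (h1 : r < 1) {c : ℝ} (hc : 0 < c)
    {α : ℝ} (hα : 0 < α) (β : ℝ) :
    ∃ M, 0 ≤ M ∧ ∀ b : ℝ, |b| ∈ Set.Icc α β → ∀ k : ℕ, |latticeFun r c b k| ≤ M := by
  obtain ⟨M, hM0, hM⟩ := exists_abs_rhoInt_le h0 h1 β
  have hy : 0 < r ^ 2 / c := by positivity
  obtain ⟨S, hS⟩ : Summable fun j : ℤ => M * (r ^ (j * (j - 1)) * |α * (r ^ 2 / c)| ^ j +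
      r ^ (j * (j - 1)) * |β * (r ^ 2 / c)| ^ j) :=
    ((summable_theta h0 h1 _).add (summable_theta h0 h1 _)).mul_left M
  refine ⟨S, hS.nonneg fun j => by positivity, fun b hb k => ?_⟩
  have hb0 : b ≠ 0 := abs_pos.mp (hα.trans_le hb.1)
  refine (abs_latticeFun_natCast_le h0 h1 hc hb0 k).trans ?_
  rw [← Real.norm_eq_abs]
  refine tsum_of_norm_bounded hS fun j => ?_
  rw [norm_mul, norm_mul, norm_zpow, norm_zpow, Real.norm_of_nonneg h0.le, Real.norm_eq_abs,
    Real.norm_eq_abs, ← mul_add]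
  gcongr
  · exact hM b hb.2 _
  · refine zpow_le_zpow_add_zpow (by positivity) ?_ j
    simp only [abs_mul, abs_of_pos hy, abs_of_pos hα]
    exact ⟨mul_le_mul_of_nonneg_right hb.1 hy.le,
      mul_le_mul_of_nonneg_right (hb.2.trans (le_abs_self β)) hy.le⟩

theorem exists_abs_entireFun_le (h0 : 0 < r) (h1 : r < 1) (β ζ : ℝ) :
    ∃ M, 0 ≤ M ∧ ∀ b z : ℝ, |b| ≤ β → |z| ≤ ζ → |entireFun r b z| ≤ M := by
  have hr := norm_lt_one_of_pos h0 h1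
  obtain ⟨M, hM⟩ := exists_norm_coeff_rhoSeries_le hr β
  obtain ⟨S, hS⟩ : Summable fun n : ℕ => |M| * (r ^ (n * (n - 1)) * |β * ζ| ^ n) :=
    (summable_pow_mul_pred_mul_pow h0.le h1 _).mul_left |M|
  refine ⟨S, hS.nonneg fun n => by positivity, fun b z hb hz => ?_⟩
  rw [← Real.norm_eq_abs, entireFun, seriesEval]
  refine tsum_of_norm_bounded hS fun n => ?_
  rw [norm_coeff_entireSeries_mul_pow hr, Real.norm_of_nonneg h0.le, Real.norm_eq_abs b,
    Real.norm_eq_abs z, abs_of_nonneg (by positivity : 0 ≤ |b| * |z|), abs_mul β]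
  have hM' := (hM b hb n).trans (le_abs_self M)
  have hβ := hb.trans (le_abs_self β)
  have hζ := hz.trans (le_abs_self ζ)
  gcongr

theorem exists_abs_latticeFun_neg_natCast_le (h0 : 0 < r) (h1 : r < 1) {c : ℝ} (hc : 0 < c)
    (β : ℝ) : ∃ M, 0 ≤ M ∧ ∀ b : ℝ, |b| ≤ β → ∀ n : ℕ, |latticeFun r c b (-n)| ≤ M * β ^ n := by
  obtain ⟨M, hM0, hM⟩ := exists_abs_entireFun_le h0 h1 β (r ^ 2 / c)
  refine ⟨M, hM0, fun b hb n => ?_⟩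
  have hnode : |node r c (-n)| ≤ r ^ 2 / c := by
    rw [node, abs_neg, abs_of_pos (by positivity), sub_neg_eq_add,
      show 2 * (1 + (n : ℤ)) = ((2 * (1 + n) : ℕ) : ℤ) by push_cast; rfl, zpow_natCast]
    gcongr ?_ / c
    exact pow_le_pow_of_le_one h0.le h1.le (by omega)
  rw [latticeFun, neg_neg, zpow_natCast, abs_mul, abs_pow, abs_div, mul_comm]
  refine mul_le_mul ?_ (by gcongr) (by positivity) hM0
  exact (div_le_self (abs_nonneg _)
    ((one_le_qPochInf_node h0 h1 hc (-n)).trans (le_abs_self _))).trans (hM b _ hb hnode)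

theorem exists_summable_norm_latticeFun_mul_le (h0 : 0 < r) (h1 : r < 1) {c : ℝ} (hc : 0 < c)
    {α : ℝ} (hα : 0 < α) (β : ℝ) : ∃ g : ℤ → ℝ, Summable g ∧ ∀ b b' : ℝ,
      |b| ∈ Set.Icc α β → |b'| ∈ Set.Icc α β →
        ∀ k, ‖latticeFun r c b k * latticeFun r c b' k * latticeWeight r c k‖ ≤ g k := by
  obtain ⟨M, hM0, hM⟩ := exists_abs_latticeFun_natCast_le h0 h1 hc hα β
  obtain ⟨N, hN0, hN⟩ := exists_abs_latticeFun_neg_natCast_le h0 h1 hc β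
  set G : ℕ → ℝ := fun n => N * N * (r ^ (n * (n - 1)) * |β ^ 2 * (r / c)| ^ n) with hG
  have hGs : Summable G := (summable_pow_mul_pred_mul_pow h0.le h1 (β ^ 2 * (r / c))).mul_left _
  refine ⟨fun k => if 0 ≤ k then M * M * r ^ k.toNat else G (-k).toNat, ?_, ?_⟩
  · refine Summable.of_nat_of_neg_add_one ?_ ?_
    · simpa using (summable_geometric_of_lt_one h0.le h1).mul_left (M * M)
    · refine ((summable_nat_add_iff 1).mpr hGs).congr fun n => ?_
      rw [if_neg (by omega)]
      congr 1
  intro b b' hb hb' k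
  have hβ : 0 ≤ β := (abs_nonneg b).trans hb.2
  have hw := latticeWeight_nonneg h0 h1 hc k
  rw [norm_mul, norm_mul, Real.norm_of_nonneg hw, Real.norm_eq_abs, Real.norm_eq_abs]
  dsimp only
  split_ifs with hk
  · lift k to ℕ using hk
    have hwle := latticeWeight_natCast_le h0 h1 hc k
    have hbk := hM b hb k
    have hbk' := hM b' hb' k
    rw [Int.toNat_natCast]
    gcongr
  · obtain ⟨n, rfl⟩ := Int.exists_eq_neg_ofNat (not_le.mp hk).le
    have hwle := latticeWeight_neg_natCast_le h0 h1 hc n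
    have hbn := hN b hb.2 n
    have hbn' := hN b' hb'.2 n
    rw [neg_neg, Int.toNat_natCast]
    calc _ ≤ N * β ^ n * (N * β ^ n) * (r ^ (n * (n - 1)) * (r / c) ^ n) := by gcongr
      _ = G n := by
        rw [hG, abs_of_nonneg (by positivity)]
        ring

theorem summable_latticeFun_mul (h0 : 0 < r) (h1 : r < 1) {c : ℝ} (hc : 0 < c) {b b' : ℝ}
    (hb : b ≠ 0) (hb' : b' ≠ 0) :
    Summable fun k => latticeFun r c b k * latticeFun r c b' k * latticeWeight r c k := by
  obtain ⟨g, hg, hle⟩ := exists_summable_norm_latticeFun_mul_le h0 h1 hc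
    (lt_min (abs_pos.mpr hb) (abs_pos.mpr hb')) (max |b| |b'|)
  exact hg.of_norm_bounded
    (hle b b' ⟨min_le_left _ _, le_max_left _ _⟩ ⟨min_le_right _ _, le_max_right _ _⟩)

theorem wronskian_eq_casoratian (h0 : 0 < r) (h1 : r < 1) {c : ℝ} (hc : 0 < c) {b b' : ℝ}
    (hb : b ≠ 0) (hb' : b' ≠ 0) (k : ℤ) :
    wronskian r c b b' k = r ^ (1 - k) *
      (latticeFun r c b (k - 1) * latticeFun r c b' k -
        latticeFun r c b k * latticeFun r c b' (k - 1)) /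
      qPochInf (-(c * r ^ (2 * k))) (r ^ 2) := by
  have hdiff := latticeFun_sub_succ h0 h1 hc hb (k - 1)
  have hdiff' := latticeFun_sub_succ h0 h1 hc hb' (k - 1)
  rw [sub_add_cancel] at hdiff hdiff'
  have hk : r ^ (1 - k) * r ^ k = r := by rw [← zpow_add₀ h0.ne']; simp
  rw [wronskian]
  congr 1
  linear_combination (-(r ^ (1 - k) * latticeFun r c b' k)) * hdiff +
    (r ^ (1 - k) * latticeFun r c b k) * hdiff' -
    ((b - 1) * (latticeFun r c (b * r) k * latticeFun r c b' k) -
      (b' - 1) * (latticeFun r c b k * latticeFun r c (b' * r) k)) * hk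

theorem qPochInf_weight_succ (h0 : 0 < r) (h1 : r < 1) (c : ℝ) (k : ℤ) :
    qPochInf (-(c * r ^ (2 * k))) (r ^ 2) =
      (1 + c * r ^ (2 * k)) * qPochInf (-(c * r ^ (2 * (k + 1)))) (r ^ 2) := by
  rw [qPochInf_eq_one_sub_mul (norm_sq_lt_one (norm_lt_one_of_pos h0 h1)), mul_add,
    zpow_add₀ h0.ne', sub_neg_eq_add, mul_one, zpow_ofNat, neg_mul, mul_assoc]

theorem wronskian_sub (h0 : 0 < r) (h1 : r < 1) {c : ℝ} (hc : 0 < c) {b b' : ℝ}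
    (hb : b ≠ 0) (hb' : b' ≠ 0) (k : ℤ) :
    wronskian r c b b' (k + 1) - wronskian r c b b' k =
      c * (1 / b' - 1 / b) *
        (latticeFun r c b k * latticeFun r c b' k * latticeWeight r c k) := by
  have hQ : qPochInf (-(c * r ^ (2 * (k + 1)))) (r ^ 2) ≠ 0 := by
    linarith [one_le_qPochInf_weight h0 h1 hc (k + 1)]
  have hx : 1 + c * r ^ (2 * k) ≠ 0 := by positivity
  have hs : r ^ k ≠ 0 := zpow_ne_zero _ h0.ne'
  have hr2 : r ^ (2 * k) = r ^ k * r ^ k := by rw [two_mul, zpow_add₀ h0.ne']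
  have hrec := latticeFun_recurrence h0 h1 hc hb k
  have hrec' := latticeFun_recurrence h0 h1 hc hb' k
  rw [wronskian_eq_casoratian h0 h1 hc hb hb', wronskian_eq_casoratian h0 h1 hc hb hb',
    latticeWeight, qPochInf_weight_succ h0 h1 c k, add_sub_cancel_right,
    show 1 - (k + 1) = -k by ring, zpow_sub₀ h0.ne', zpow_one, zpow_neg]
  rw [hr2] at hx hrec hrec' ⊢
  field_simp at hrec hrec' ⊢
  linear_combination b' * latticeFun r c b' k * hrec - b * latticeFun r c b k * hrec'

theorem tendsto_qPochInf_weight (h0 : 0 < r) (h1 : r < 1) {c : ℝ} (hc : 0 < c) :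
    Tendsto (fun n : ℕ => qPochInf (-(c * r ^ (2 * (n : ℤ)))) (r ^ 2)) atTop (𝓝 1) := by
  have hp := norm_sq_lt_one (norm_lt_one_of_pos h0 h1)
  have hQ : qPochInf (-c) (r ^ 2) ≠ 0 := by
    linarith [one_le_qPochInf hc.le (sq_nonneg r) (by nlinarith)]
  have h := (tendsto_const_nhds (x := qPochInf (-c) (r ^ 2))).div (tendsto_qPoch hp (-c)) hQ
  rw [div_self hQ] at h
  refine h.congr fun n => ?_
  rw [Pi.div_apply, qPochInf_eq_qPoch_mul hp (-c) n, mul_div_cancel_left₀ _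
    (by linarith [one_le_qPoch hc.le (sq_nonneg r) n]), zpow_mul, zpow_natCast, zpow_ofNat, neg_mul]

theorem tendsto_wronskian (h0 : 0 < r) (h1 : r < 1) {c : ℝ} (hc : 0 < c) {b b' : ℝ}
    (hb : b ≠ 0) (hb' : b' ≠ 0) :
    Tendsto (fun n : ℕ => wronskian r c b b' n) atTop (𝓝 (wronskianLim r c b b')) := by
  have hf {x : ℝ} (hx : x ≠ 0) := tendsto_latticeFun h0 h1 hc hx
  have h := ((((hf (mul_ne_zero hb h0.ne')).mul (hf hb')).const_mul (b - 1)).sub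
    (((hf hb).mul (hf (mul_ne_zero hb' h0.ne'))).const_mul (b' - 1))).const_mul r
  have hlim : wronskianLim r c b b' = r * ((b - 1) * (valueLim r c (b * r) * valueLim r c b') -
      (b' - 1) * (valueLim r c b * valueLim r c (b' * r))) / 1 := by
    rw [wronskianLim, slopeLim, slopeLim]
    ring
  exact hlim ▸ h.div (tendsto_qPochInf_weight h0 h1 hc) one_ne_zero

theorem tendsto_wronskian_neg (h0 : 0 < r) (h1 : r < 1) {c : ℝ} (hc : 0 < c) {b b' : ℝ}
    (hb : b ≠ 0) (hb' : b' ≠ 0) :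
    Tendsto (fun n : ℕ => wronskian r c b b' (-n)) atTop (𝓝 0) := by
  have hprod {x y : ℝ} (hx : x ≠ 0) (hy : y ≠ 0) : Tendsto (fun n : ℕ => r ^ n *
      (latticeFun r c x (-n) * latticeFun r c y (-n) * latticeWeight r c (-n))) atTop (𝓝 0) := by
    have hinj : Function.Injective fun n : ℕ => -(n : ℤ) := fun m n h => by simpa using h
    simpa using (tendsto_pow_atTop_nhds_zero_of_lt_one h0.le h1).mul
      ((summable_latticeFun_mul h0 h1 hc hx hy).comp_injective hinj).tendsto_atTop_zero
  have h := (((hprod (mul_ne_zero hb h0.ne') hb').const_mul (b - 1)).sub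
    ((hprod hb (mul_ne_zero hb' h0.ne')).const_mul (b' - 1))).const_mul r
  simp only [mul_zero, sub_zero] at h
  refine h.congr fun n => ?_
  rw [wronskian, latticeWeight, zpow_neg, zpow_natCast]
  field_simp [h0.ne']

theorem hasSum_latticeFun_mul (h0 : 0 < r) (h1 : r < 1) {c : ℝ} (hc : 0 < c) {b b' : ℝ}
    (hb : b ≠ 0) (hb' : b' ≠ 0) :
    HasSum (fun k => c * (1 / b' - 1 / b) *
        (latticeFun r c b k * latticeFun r c b' k * latticeWeight r c k))
      (wronskianLim r c b b') := by
  have hs := (summable_latticeFun_mul h0 h1 hc hb hb').mul_left (c * (1 / b' - 1 / b))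
  simp only [← wronskian_sub h0 h1 hc hb hb'] at hs ⊢
  simpa only [sub_zero] using hasSum_sub_of_tendsto hs (tendsto_wronskian h0 h1 hc hb hb')
    (tendsto_wronskian_neg h0 h1 hc hb hb')

theorem continuous_entireFun_left (h0 : 0 < r) (h1 : r < 1) (z : ℝ) :
    Continuous fun b => entireFun r b z := by
  have hr := norm_lt_one_of_pos h0 h1
  refine continuous_iff_continuousAt.mpr fun b => ?_
  obtain ⟨M, hM⟩ := exists_norm_coeff_rhoSeries_le hr (|b| + 1)
  have hcoeff (n : ℕ) : Continuous fun x => coeff n (entireSeries r x) := by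
    simp only [entireSeries, coeff_mul, phiSeries, coeff_mk, qPoch]
    fun_prop
  refine tendsto_tsum_of_dominated_convergence
    ((summable_pow_mul_pred_mul_pow h0.le h1 ((|b| + 1) * z)).mul_left |M|)
    (fun n => ((hcoeff n).tendsto b).mul_const _) ?_
  filter_upwards [(continuous_abs.tendsto b).eventually_lt_const (lt_add_one _)] with x hx n
  have hM' := (hM x hx.le n).trans (le_abs_self M)
  rw [norm_coeff_entireSeries_mul_pow hr, Real.norm_of_nonneg h0.le, Real.norm_eq_abs x,
    Real.norm_eq_abs z, abs_of_nonneg (by positivity : 0 ≤ |x| * |z|), abs_mul (|b| + 1),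
    abs_of_nonneg (by positivity : 0 ≤ |b| + 1)]
  gcongr

theorem continuousAt_latticeFun (h0 : 0 < r) (h1 : r < 1) (c : ℝ) {b : ℝ} (hb : b ≠ 0) (k : ℤ) :
    ContinuousAt (fun x => latticeFun r c x k) b :=
  (continuousAt_zpow₀ b (-k) (.inl hb)).mul
    ((continuous_entireFun_left h0 h1 _).continuousAt.div_const _)

theorem tendsto_tsum_latticeFun_mul (h0 : 0 < r) (h1 : r < 1) {c : ℝ} (hc : 0 < c) {b : ℝ}
    (hb : b ≠ 0) :
    Tendsto (fun b' => ∑' k, latticeFun r c b k * latticeFun r c b' k * latticeWeight r c k)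
      (𝓝 b) (𝓝 (∑' k, latticeFun r c b k * latticeFun r c b k * latticeWeight r c k)) := by
  have hb0 : 0 < |b| := abs_pos.mpr hb
  obtain ⟨g, hg, hle⟩ := exists_summable_norm_latticeFun_mul_le h0 h1 hc (half_pos hb0) (2 * |b|)
  refine tendsto_tsum_of_dominated_convergence hg
    (fun k => ((continuousAt_latticeFun h0 h1 c hb k).const_mul _).mul_const _) ?_
  filter_upwards [(continuous_abs.tendsto b).eventually_le_const (by linarith : |b| < 2 * |b|),
    (continuous_abs.tendsto b).eventually_const_le (half_lt_self hb0)] with x hx hx' k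
  exact hle b x ⟨by linarith, by linarith⟩ ⟨hx', hx⟩ k

theorem hasSum_latticeFun_sq_of_tendsto (h0 : 0 < r) (h1 : r < 1) {c : ℝ} (hc : 0 < c) {b N : ℝ}
    (hb : b ≠ 0)
    (hN : Tendsto (fun x => wronskianLim r c b (b * x) / (c * (1 / (b * x) - 1 / b))) (𝓝[≠] 1)
      (𝓝 N)) :
    HasSum (fun k => latticeFun r c b k * latticeFun r c b k * latticeWeight r c k) N := by
  suffices heq : ∑' k, latticeFun r c b k * latticeFun r c b k * latticeWeight r c k = N from
    heq ▸ (summable_latticeFun_mul h0 h1 hc hb hb).hasSum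
  have hmul : Tendsto (fun x => b * x) (𝓝 1) (𝓝 b) := by
    simpa using (continuous_const_mul b).tendsto 1
  refine tendsto_nhds_unique (((tendsto_tsum_latticeFun_mul h0 h1 hc hb).comp hmul).mono_left
    nhdsWithin_le_nhds) (hN.congr' ?_)
  filter_upwards [(isOpen_ne.eventually_mem one_ne_zero).filter_mono nhdsWithin_le_nhds,
    self_mem_nhdsWithin] with x hx hne
  have hbx : b * x ≠ 0 := mul_ne_zero hb hx
  have hcoeff : c * (1 / (b * x) - 1 / b) ≠ 0 :=
    mul_ne_zero hc.ne' (sub_ne_zero.mpr fun h => hne (by simpa [hb] using h))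
  rw [div_eq_iff hcoeff, ← (hasSum_latticeFun_mul h0 h1 hc hb hbx).tsum_eq, tsum_mul_left, mul_comm,
    Function.comp_apply]

theorem hasSum_latticeFun_mul_eq_zero (h0 : 0 < r) (h1 : r < 1) {c : ℝ} (hc : 0 < c) {b b' : ℝ}
    (hb : b ≠ 0) (hb' : b' ≠ 0) (hne : b ≠ b')
    (h : wronskianLim r c b b' = 0) :
    HasSum (fun k => latticeFun r c b k * latticeFun r c b' k * latticeWeight r c k) 0 := by
  have hcoeff : c * (1 / b' - 1 / b) ≠ 0 :=
    mul_ne_zero hc.ne' (sub_ne_zero.mpr fun h => hne (by simpa using h.symm))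
  have hs := hasSum_latticeFun_mul h0 h1 hc hb hb'
  rw [h] at hs
  simpa only [mul_zero, inv_mul_cancel_left₀ hcoeff] using hs.mul_left (c * (1 / b' - 1 / b))⁻¹

end Summation

/-! ### Theta functions and the norms -/

section Norms

/-- The values `-c r^{-m}` of the parameter `b` that belong to the functions `k̃_m`. -/
noncomputable def param (r c : ℝ) (m : ℤ) : ℝ := -(c * r ^ (-m))

/-- The determinant `u(x) θ(r^l) θ(x r^{l+1}) - v(x) θ(r^{l+1}) θ(x r^l)`, with `θ = qTheta r²`. At
the parameters `b = param r c (2 - l)` and `b x`, the limit of the Wronskian has this form. -/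
noncomputable def thetaCross (r : ℝ) (u v : ℝ → ℝ) (l : ℤ) (x : ℝ) : ℝ :=
  u x * (qTheta (r ^ 2) (r ^ l) * qTheta (r ^ 2) (x * r ^ (l + 1))) -
    v x * (qTheta (r ^ 2) (r ^ (l + 1)) * qTheta (r ^ 2) (x * r ^ l))

/-- The squared norm of `latticeFun r c (param r c m)` on one half of the lattice. -/
noncomputable def halfNorm (r c : ℝ) (m : ℤ) : ℝ :=
  qPochInf (r ^ 2) (r ^ 2) ^ 2 * qTheta (r ^ 2) (-(c * r)) / qTheta (r ^ 2) (-c) *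
    (c ^ m * r ^ (-(m ^ 2))) / qPochInf (-(c⁻¹ * r ^ (m + 1))) r

theorem continuous_qPochInf {p : ℝ} (hp : ‖p‖ < 1) : Continuous fun x => qPochInf x p := by
  have h := continuous_seriesEval (absConvAt_eulerSeries hp)
  rwa [funext (seriesEval_eulerSeries hp)] at h

theorem qPochInf_eq_zero {p a : ℝ} (hp : ‖p‖ < 1) {i : ℕ} (h : a * p ^ i = 1) :
    qPochInf a p = 0 := by
  rw [qPochInf_eq_qPoch_mul hp a (i + 1), qPoch_succ, h, sub_self, mul_zero, zero_mul]

theorem qPochInf_eq_mul_qPochInf_sq {p : ℝ} (hp : ‖p‖ < 1) (a : ℝ) :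
    qPochInf a p = qPochInf a (p ^ 2) * qPochInf (a * p) (p ^ 2) := by
  have hfinite (n : ℕ) : qPoch a p (2 * n) = qPoch a (p ^ 2) n * qPoch (a * p) (p ^ 2) n := by
    induction n with
    | zero => simp only [mul_zero, qPoch_zero_right, mul_one]
    | succ n ih =>
      rw [show 2 * (n + 1) = 2 * n + 1 + 1 by ring, qPoch_succ, qPoch_succ, ih, qPoch_succ,
        qPoch_succ]
      ring
  have hdouble : Tendsto (fun n => 2 * n) atTop (atTop : Filter ℕ) :=
    tendsto_id.const_mul_atTop' two_pos
  refine tendsto_nhds_unique ((tendsto_qPoch hp a).comp hdouble) ?_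
  simp only [Function.comp_def, hfinite]
  exact (tendsto_qPoch (norm_sq_lt_one hp) a).mul (tendsto_qPoch (norm_sq_lt_one hp) (a * p))

theorem qTheta_mul_base {p : ℝ} (hp0 : p ≠ 0) (hp : ‖p‖ < 1) {x : ℝ} (hx : x ≠ 0) :
    qTheta p (x * p) = -x⁻¹ * qTheta p x := by
  have hinv : p / (x * p) = x⁻¹ := by field_simp
  rw [qTheta, qTheta, hinv, qPochInf_eq_one_sub_mul hp x, qPochInf_eq_one_sub_mul hp x⁻¹,
    inv_mul_eq_div]
  field_simp
  ring

theorem succ_mul_ediv_two (l : ℤ) : (l + 1) * (l + 1 - 1) / 2 = l + l * (l - 1) / 2 := by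
  rw [show (l + 1) * (l + 1 - 1) = l * (l - 1) + l * 2 by ring,
    Int.add_mul_ediv_right _ _ two_ne_zero, add_comm]

theorem qTheta_mul_zpow {p : ℝ} (hp0 : p ≠ 0) (hp : ‖p‖ < 1) {x : ℝ} (hx : x ≠ 0) (m : ℤ) :
    qTheta p (x * p ^ m) = ((-x) ^ m * p ^ (m * (m - 1) / 2))⁻¹ * qTheta p x := by
  have hperiodic : Function.Periodic
      (fun l : ℤ => (-x) ^ l * p ^ (l * (l - 1) / 2) * qTheta p (x * p ^ l)) 1 := fun l => by
    have hpl : p ^ l ≠ 0 := zpow_ne_zero l hp0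
    dsimp only
    rw [succ_mul_ediv_two, zpow_add₀ hp0, zpow_add_one₀ hp0, zpow_add_one₀ (neg_ne_zero.mpr hx),
      ← mul_assoc x, qTheta_mul_base hp0 hp (mul_ne_zero hx hpl)]
    field_simp
  have h := hperiodic.int_mul_eq m
  simp only [mul_one, Int.cast_id, zpow_zero, zero_mul, Int.zero_ediv] at h
  have hunit : (-x) ^ m * p ^ (m * (m - 1) / 2) ≠ 0 :=
    mul_ne_zero (zpow_ne_zero _ (neg_ne_zero.mpr hx)) (zpow_ne_zero _ hp0)
  rw [eq_inv_mul_iff_mul_eq₀ hunit, h, one_mul]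

theorem qTheta_zpow {p : ℝ} (hp0 : p ≠ 0) (hp : ‖p‖ < 1) (j : ℤ) : qTheta p (p ^ j) = 0 := by
  rcases le_or_gt j 0 with hj | hj
  · obtain ⟨i, rfl⟩ := Int.exists_eq_neg_ofNat hj
    refine mul_eq_zero_of_left (qPochInf_eq_zero hp (i := i) ?_) _
    rw [zpow_neg, zpow_natCast, inv_mul_cancel₀ (pow_ne_zero i hp0)]
  · obtain ⟨i, rfl⟩ := Int.eq_succ_of_zero_lt hj
    refine mul_eq_zero_of_right _ (qPochInf_eq_zero hp (i := i) ?_)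
    rw [← Nat.cast_succ, zpow_natCast, pow_succ]
    field_simp

theorem qTheta_eq_mul_qTheta_sq {p : ℝ} (hp0 : p ≠ 0) (hp : ‖p‖ < 1) (x : ℝ) :
    qTheta p x = qTheta (p ^ 2) x * qTheta (p ^ 2) (x * p) := by
  have hdiv : p ^ 2 / (x * p) = p / x := by field_simp
  rw [qTheta, qTheta, qTheta, hdiv, qPochInf_eq_mul_qPochInf_sq hp x,
    qPochInf_eq_mul_qPochInf_sq hp (p / x), div_mul_eq_mul_div, ← sq]
  ring

variable {r : ℝ}

theorem param_ne_zero (h0 : 0 < r) {c : ℝ} (hc : 0 < c) (m : ℤ) : param r c m ≠ 0 :=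
  neg_ne_zero.mpr (mul_pos hc (zpow_pos h0 _)).ne'

theorem param_injective (h0 : 0 < r) (h1 : r < 1) {c : ℝ} (hc : 0 < c) :
    Function.Injective (param r c) := fun _ _ h =>
  neg_injective (zpow_right_injective₀ h0 h1.ne (mul_left_cancel₀ hc.ne' (neg_injective h)))

theorem param_mul (h0 : 0 < r) (c : ℝ) (m : ℤ) : param r c m * r = param r c (m - 1) := by
  rw [param, param, neg_mul, mul_assoc, ← zpow_add_one₀ h0.ne', show -m + 1 = -(m - 1) by ring]

theorem valueLim_param_mul (h0 : 0 < r) {c : ℝ} (hc : 0 < c) (m : ℤ) (x : ℝ) :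
    valueLim r c (param r c m * x) = qPochInf (param r c m * x * r) (r ^ 2) / qPochInf r (r ^ 2) *
      (qTheta (r ^ 2) (x * r ^ (2 - m)) / qTheta (r ^ 2) (-c)) := by
  have harg : -(param r c m * x * (r ^ 2 / c)) = x * r ^ (2 - m) := by
    rw [param, sub_eq_add_neg, zpow_add₀ h0.ne', zpow_ofNat]
    field_simp
  rw [valueLim, harg]

theorem valueLim_param_of_even (h0 : 0 < r) (h1 : r < 1) {c : ℝ} (hc : 0 < c) {m : ℤ}
    (hm : Even m) : valueLim r c (param r c m) = 0 := by
  obtain ⟨l, rfl⟩ := hm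
  have h := valueLim_param_mul h0 hc (l + l) 1
  rw [one_mul, show 2 - (l + l) = 2 * (1 - l) by ring, zpow_mul, zpow_ofNat,
    qTheta_zpow (pow_ne_zero 2 h0.ne') (norm_sq_lt_one (norm_lt_one_of_pos h0 h1)), zero_div,
    mul_zero, mul_one] at h
  exact h

theorem slopeLim_param_of_odd (h0 : 0 < r) (h1 : r < 1) {c : ℝ} (hc : 0 < c) {m : ℤ}
    (hm : Odd m) : slopeLim r c (param r c m) = 0 := by
  rw [slopeLim, param_mul h0, valueLim_param_of_even h0 h1 hc (hm.sub_odd odd_one), mul_zero]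

theorem slopeLim_param_mul (h0 : 0 < r) (h1 : r < 1) {c : ℝ} (hc : 0 < c) (m : ℤ) (x : ℝ) :
    slopeLim r c (param r c m * x) = -(qPochInf (param r c m * x) (r ^ 2) / qPochInf r (r ^ 2) *
      (qTheta (r ^ 2) (x * r ^ (2 - m + 1)) / qTheta (r ^ 2) (-c))) := by
  rw [slopeLim, mul_right_comm, param_mul h0, valueLim_param_mul h0 hc, ← param_mul h0,
    qPochInf_eq_one_sub_mul (norm_sq_lt_one (norm_lt_one_of_pos h0 h1)) (param r c m * x),
    show 2 - (m - 1) = 2 - m + 1 by ring,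
    show param r c m * r * x * r = param r c m * x * r ^ 2 by ring]
  ring

theorem thetaCross_succ (h0 : 0 < r) (h1 : r < 1) (u v : ℝ → ℝ) (l : ℤ) {x : ℝ} (hx : x ≠ 0) :
    thetaCross r u v (l + 1) x = (r ^ l)⁻¹ * thetaCross r v (u / id) l x := by
  have hp := norm_sq_lt_one (norm_lt_one_of_pos h0 h1)
  have hrl : r ^ l ≠ 0 := zpow_ne_zero l h0.ne'
  have hr2 : r ^ (l + 1 + 1) = r ^ l * r ^ 2 := by
    rw [add_assoc, zpow_add₀ h0.ne']
    norm_cast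
  rw [thetaCross, thetaCross, Pi.div_apply, id_eq, hr2, ← mul_assoc x,
    qTheta_mul_base (pow_ne_zero 2 h0.ne') hp hrl,
    qTheta_mul_base (pow_ne_zero 2 h0.ne') hp (mul_ne_zero hx hrl)]
  field_simp
  ring

theorem tendsto_qTheta_div {p : ℝ} (hp : ‖p‖ < 1) :
    Tendsto (fun x => qTheta p x / (1 - x)) (𝓝[≠] 1) (𝓝 (qPochInf p p ^ 2)) := by
  have hcont : ContinuousAt (fun x => qPochInf (x * p) p * qPochInf (p / x) p) 1 :=
    ((continuous_qPochInf hp).comp (continuous_mul_const p)).continuousAt.mul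
      (ContinuousAt.comp (continuous_qPochInf hp).continuousAt
        (continuousAt_const.div continuousAt_id one_ne_zero))
  have h := hcont.tendsto.mono_left (nhdsWithin_le_nhds (s := {1}ᶜ))
  rw [one_mul, div_one, ← sq] at h
  refine h.congr' ?_
  filter_upwards [self_mem_nhdsWithin] with x hx
  have hx1 : 1 - x ≠ 0 := sub_ne_zero.mpr (Ne.symm hx)
  rw [qTheta, qPochInf_eq_one_sub_mul hp x]
  field_simp

theorem tendsto_thetaCross_zero_div (h0 : 0 < r) (h1 : r < 1) (u : ℝ → ℝ) {v : ℝ → ℝ}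
    (hv : ContinuousAt v 1) :
    Tendsto (fun x => thetaCross r u v 0 x / (1 - x)) (𝓝[≠] 1)
      (𝓝 (-(v 1 * (qPochInf r (r ^ 2) * qPochInf (r ^ 2) (r ^ 2)) ^ 2))) := by
  have hp := norm_sq_lt_one (norm_lt_one_of_pos h0 h1)
  have hθ1 : qTheta (r ^ 2) 1 = 0 := by simpa using qTheta_zpow (pow_ne_zero 2 h0.ne') hp 0
  have hθr : qTheta (r ^ 2) r = qPochInf r (r ^ 2) ^ 2 := by
    rw [qTheta, sq r, mul_div_cancel_right₀ _ h0.ne', ← sq, sq (qPochInf _ _)]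
  have h := ((hv.tendsto.mono_left (nhdsWithin_le_nhds (s := {1}ᶜ))).mul_const
    (qPochInf r (r ^ 2) ^ 2)).mul (tendsto_qTheta_div hp)
  rw [mul_assoc, ← mul_pow] at h
  refine h.neg.congr fun x => ?_
  rw [thetaCross, zero_add, zpow_zero, zpow_one, hθ1, hθr, mul_one]
  ring

theorem tendsto_thetaCross_div (h0 : 0 < r) (h1 : r < 1) (l : ℤ) {u v : ℝ → ℝ}
    (hu : ContinuousAt u 1) (hv : ContinuousAt v 1) (huv : u 1 = v 1) :
    Tendsto (fun x => thetaCross r u v l x / (1 - x)) (𝓝[≠] 1)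
      (𝓝 (-((r ^ (l * (l - 1) / 2))⁻¹ * u 1 *
        (qPochInf r (r ^ 2) * qPochInf (r ^ 2) (r ^ 2)) ^ 2))) := by
  have hne : ∀ᶠ x : ℝ in 𝓝[≠] 1, x ≠ 0 :=
    (isOpen_ne.eventually_mem one_ne_zero).filter_mono nhdsWithin_le_nhds
  have hrpow (l : ℤ) : r ^ ((l + 1) * (l + 1 - 1) / 2) = r ^ l * r ^ (l * (l - 1) / 2) := by
    rw [succ_mul_ediv_two, zpow_add₀ h0.ne']
  induction l using Int.induction_on generalizing u v with
  | zero => simpa [huv] using tendsto_thetaCross_zero_div h0 h1 u hv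
  | succ l ih =>
    have h := (ih hv (hu.div continuousAt_id one_ne_zero) (by simp [huv])).const_mul
      (r ^ (l : ℤ))⁻¹
    rw [hrpow, huv, mul_inv, mul_assoc, mul_assoc, ← mul_assoc _ (v 1), ← mul_neg]
    refine h.congr' ?_
    filter_upwards [hne] with x hx
    rw [thetaCross_succ h0 h1 u v l hx, mul_div_assoc]
  | pred l ih =>
    have hrl : r ^ (-(l : ℤ) - 1) ≠ 0 := zpow_ne_zero _ h0.ne'
    have hexp := hrpow (-(l : ℤ) - 1)
    have h := (ih (continuousAt_id.mul hv) hu (by simp [huv])).const_mul (r ^ (-(l : ℤ) - 1))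
    rw [sub_add_cancel] at hexp
    rw [hexp, mul_inv, mul_neg, mul_assoc _⁻¹, mul_assoc _⁻¹, mul_inv_cancel_left₀ hrl,
      Pi.mul_apply, id_eq, one_mul, ← huv] at h
    refine h.congr' ?_
    filter_upwards [hne] with x hx
    have hcross := thetaCross_succ h0 h1 (id * v) u (-(l : ℤ) - 1) hx
    rw [sub_add_cancel] at hcross
    rw [hcross, mul_div_assoc, mul_inv_cancel_left₀ hrl]
    simp only [thetaCross, Pi.div_apply, Pi.mul_apply, id_eq, mul_div_cancel_left₀ _ hx]

theorem qPochInf_param_mul (h0 : 0 < r) (h1 : r < 1) {c : ℝ} (hc : 0 < c) (m : ℤ) :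
    qPochInf (param r c m) r * qPochInf (-(c⁻¹ * r ^ (m + 1))) r =
      (c ^ (-m) * r ^ (-m * (-m - 1) / 2))⁻¹ * qTheta r (-c) := by
  have hdiv : r / param r c m = -(c⁻¹ * r ^ (m + 1)) := by
    rw [param, zpow_neg, zpow_add_one₀ h0.ne']
    have := zpow_ne_zero m h0.ne'
    field_simp
  have h := qTheta_mul_zpow h0.ne' (norm_lt_one_of_pos h0 h1) (neg_ne_zero.mpr hc.ne') (-m)
  rwa [neg_mul, ← param, qTheta, hdiv, neg_neg] at h

theorem halfNorm_eq (h0 : 0 < r) (h1 : r < 1) {c : ℝ} (hc : 0 < c) (m : ℤ) :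
    halfNorm r c m = r * r ^ (-m) * (r ^ ((2 - m) * (2 - m - 1) / 2))⁻¹ *
      qPochInf (param r c m) r * (qPochInf (r ^ 2) (r ^ 2) / qTheta (r ^ 2) (-c)) ^ 2 := by
  have hr := norm_lt_one_of_pos h0 h1
  have hexp : r * r ^ (-m) * (r ^ ((2 - m) * (2 - m - 1) / 2))⁻¹ * (r ^ (-m * (-m - 1) / 2))⁻¹ =
      r ^ (-(m ^ 2)) := by
    obtain ⟨e, he⟩ := (Int.even_mul_pred_self (-m)).two_dvd
    have he' : (2 - m) * (2 - m - 1) = 2 * (e + 1 - 2 * m) := by linarith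
    rw [he, he', Int.mul_ediv_cancel_left _ two_ne_zero, Int.mul_ediv_cancel_left _ two_ne_zero,
      ← zpow_neg, ← zpow_neg, ← zpow_one_add₀ h0.ne', ← zpow_add₀ h0.ne', ← zpow_add₀ h0.ne']
    congr 1
    linarith
  have hQ : qPochInf (-(c⁻¹ * r ^ (m + 1))) r ≠ 0 := by
    linarith [one_le_qPochInf (by positivity : 0 ≤ c⁻¹ * r ^ (m + 1)) h0.le h1]
  have hθ := (qTheta_neg_pos (pow_pos h0 2) (pow_lt_one₀ h0.le h1 two_ne_zero) hc).ne'
  have hprod := qPochInf_param_mul h0 h1 hc m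
  rw [mul_inv, zpow_neg, inv_inv, qTheta_eq_mul_qTheta_sq h0.ne' hr, neg_mul c] at hprod
  rw [halfNorm, ← hexp, div_eq_iff hQ, mul_right_comm _ _ (qPochInf (-_) r),
    mul_assoc _ _ (qPochInf (-_) r), hprod]
  field_simp

theorem wronskianLim_param_mul (h0 : 0 < r) (h1 : r < 1) {c : ℝ} (hc : 0 < c) (m : ℤ) (x : ℝ) :
    wronskianLim r c (param r c m) (param r c m * x) =
      r / (qPochInf r (r ^ 2) * qTheta (r ^ 2) (-c)) ^ 2 * thetaCross r
        (fun x => qPochInf (param r c m * r) (r ^ 2) * qPochInf (param r c m * x) (r ^ 2))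
        (fun x => qPochInf (param r c m) (r ^ 2) * qPochInf (param r c m * x * r) (r ^ 2))
        (2 - m) x := by
  have hvalue := valueLim_param_mul h0 hc m 1
  have hslope := slopeLim_param_mul h0 h1 hc m 1
  rw [mul_one, one_mul] at hvalue hslope
  rw [wronskianLim, hvalue, hslope, valueLim_param_mul h0 hc, slopeLim_param_mul h0 h1 hc,
    thetaCross]
  ring

theorem tendsto_wronskianLim_div (h0 : 0 < r) (h1 : r < 1) {c : ℝ} (hc : 0 < c) (m : ℤ) :
    Tendsto (fun x => wronskianLim r c (param r c m) (param r c m * x) /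
      (c * (1 / (param r c m * x) - 1 / param r c m))) (𝓝[≠] 1) (𝓝 (halfNorm r c m)) := by
  have hb := param_ne_zero h0 hc m
  set b := param r c m with hb_def
  have hr := norm_lt_one_of_pos h0 h1
  have hp := norm_sq_lt_one hr
  have hr0 := qPochInf_ne_zero_of_norm_lt_one hp hr
  have hcont := continuous_qPochInf hp
  have hcross := tendsto_thetaCross_div h0 h1 (2 - m)
    (u := fun x => qPochInf (b * r) (r ^ 2) * qPochInf (b * x) (r ^ 2))
    (v := fun x => qPochInf b (r ^ 2) * qPochInf (b * x * r) (r ^ 2))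
    (by fun_prop) (by fun_prop) (by simp only [mul_one]; ring)
  have hcoeff : Tendsto (fun x => r * (b * x / c) / (qPochInf r (r ^ 2) * qTheta (r ^ 2) (-c)) ^ 2)
      (𝓝[≠] 1) (𝓝 (r * (b * 1 / c) / (qPochInf r (r ^ 2) * qTheta (r ^ 2) (-c)) ^ 2)) :=
    (Continuous.tendsto (by fun_prop) 1).mono_left nhdsWithin_le_nhds
  convert (hcoeff.mul hcross).congr' ?_ using 2
  · rw [halfNorm_eq h0 h1 hc, qPochInf_eq_mul_qPochInf_sq hr (param r c m), ← hb_def, mul_one,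
      show b / c = -r ^ (-m) by rw [hb_def, param]; field_simp]
    field_simp
  filter_upwards [(isOpen_ne.eventually_mem one_ne_zero).filter_mono nhdsWithin_le_nhds,
    self_mem_nhdsWithin] with x hx hne
  have hx1 : 1 - x ≠ 0 := sub_ne_zero.mpr (Ne.symm hne)
  rw [hb_def, wronskianLim_param_mul h0 h1 hc, ← hb_def]
  field_simp

theorem hasSum_latticeFun_param_sq (h0 : 0 < r) (h1 : r < 1) {c : ℝ} (hc : 0 < c) (m : ℤ) :
    HasSum (fun k => latticeFun r c (param r c m) k * latticeFun r c (param r c m) k *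
      latticeWeight r c k) (halfNorm r c m) :=
  hasSum_latticeFun_sq_of_tendsto h0 h1 hc (param_ne_zero h0 hc m)
    (tendsto_wronskianLim_div h0 h1 hc m)

end Norms

/-! ### The lattice functions in terms of `r = q⁻²` -/

section Conversion

variable {q : ℝ}

theorem zpow_neg_two_pos (hq : 1 < q) : 0 < q ^ (-2 : ℤ) := zpow_pos (one_pos.trans hq) _

theorem zpow_neg_two_lt_one (hq : 1 < q) : q ^ (-2 : ℤ) < 1 :=
  zpow_lt_one_of_neg₀ hq (by norm_num)

theorem zpow_neg_two_sq (q : ℝ) : (q ^ (-2 : ℤ)) ^ 2 = q ^ (-4 : ℤ) := by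
  rw [← zpow_natCast, ← zpow_mul]
  norm_num

theorem cst_pos (hq : 1 < q) (γ : ℝ) : 0 < cst q γ := Real.rpow_pos_of_pos (one_pos.trans hq) _

theorem pt_sq (hq : 1 < q) (γ : ℝ) (σ : ℤˣ) (k : ℤ) :
    pt q γ σ k ^ 2 = cst q γ * (q ^ (-2 : ℤ)) ^ (2 * k) := by
  have hσ : ((σ : ℤ) : ℝ) ^ 2 = 1 := by rcases Int.units_eq_one_or σ with rfl | rfl <;> norm_num
  rw [pt, mul_pow, mul_pow, hσ, Real.sq_sqrt (cst_pos hq γ).le, zpow_mul q, one_mul, mul_comm 2 k,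
    zpow_mul _ k, zpow_ofNat]

theorem neg_div_pt_sq_eq_node (hq : 1 < q) (γ : ℝ) (σ : ℤˣ) (k : ℤ) :
    -(q ^ (-4 : ℤ) / pt q γ σ k ^ 2) = node (q ^ (-2 : ℤ)) (cst q γ) k := by
  rw [pt_sq hq, node, mul_sub, zpow_sub₀ (zpow_neg_two_pos hq).ne', ← zpow_neg_two_sq, mul_one,
    zpow_ofNat, div_div, mul_comm (cst q γ)]

theorem param_eq (hq : 1 < q) (γ : ℝ) (m : ℤ) :
    param (q ^ (-2 : ℤ)) (cst q γ) m = -q ^ (2 * (m : ℝ) - 2 * γ) := by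
  have hq0 : 0 < q := one_pos.trans hq
  rw [param, cst, ← zpow_mul, ← Real.rpow_intCast q (-2 * -m), ← Real.rpow_add hq0]
  congr 2
  push_cast
  ring

theorem param_mul_eq (hq : 1 < q) (γ : ℝ) (m : ℤ) :
    param (q ^ (-2 : ℤ)) (cst q γ) m * q ^ (-2 : ℤ) = -q ^ (2 * (m : ℝ) - 2 * γ - 2) := by
  rw [param_mul (zpow_neg_two_pos hq), param_eq hq]
  congr 2
  push_cast
  ring

theorem neg_eps_eq (hq : 1 < q) (γ : ℝ) (m : ℤ) :
    -eps q γ m = (param (q ^ (-2 : ℤ)) (cst q γ) m)⁻¹ := by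
  rw [param_eq hq, eps, inv_neg, ← Real.rpow_neg (one_pos.trans hq).le, neg_sub]

theorem zpow_mul_phi21_node (hq : 1 < q) {c : ℝ} (hc : 0 < c) (b : ℝ) (k : ℤ) :
    (b ^ (-k) : ℝ) * phi21 ((b * q ^ (-2 : ℤ) : ℝ) : ℂ) (b : ℂ) 0 ((q ^ (-4 : ℤ) : ℝ) : ℂ)
      ((node (q ^ (-2 : ℤ)) c k : ℝ) : ℂ) = ((latticeFun (q ^ (-2 : ℤ)) c b k : ℝ) : ℂ) := by
  have hr := zpow_neg_two_pos hq
  rw [← zpow_neg_two_sq, phi21_ofReal hr (zpow_neg_two_lt_one hq) b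
    ((node_neg hr hc k).trans one_pos), latticeFun, Complex.ofReal_mul]

theorem zpow_mul_kPhi_pt (hq : 1 < q) (γ : ℝ) (m : ℤ) (σ : ℤˣ) (k : ℤ) :
    (((-eps q γ m) ^ k : ℝ) : ℂ) * kPhi q γ m (pt q γ σ k) =
      ((latticeFun (q ^ (-2 : ℤ)) (cst q γ) (param (q ^ (-2 : ℤ)) (cst q γ) m) k : ℝ) : ℂ) := by
  rw [← zpow_mul_phi21_node hq (cst_pos hq γ), kPhi, param_mul_eq hq, neg_eps_eq hq, inv_zpow',
    neg_div_pt_sq_eq_node hq, param_eq hq]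

theorem kTilde_eq (hq : 1 < q) (γ : ℝ) (m : ℤ) (σ : ℤˣ) (k : ℤ) :
    kTilde q γ m σ k = (((((σ ^ (m + 1) : ℤˣ) : ℤ) : ℝ) *
      latticeFun (q ^ (-2 : ℤ)) (cst q γ) (param (q ^ (-2 : ℤ)) (cst q γ) m) k : ℝ) : ℂ) := by
  rw [kTilde, Complex.ofReal_mul, Complex.ofReal_mul, mul_assoc, zpow_mul_kPhi_pt hq]

theorem hTilde_eq (hq : 1 < q) (γ : ℝ) (n : ℕ) (σ : ℤˣ) (k : ℤ) :
    hTilde q n (pt q γ σ k) = (((((σ ^ n : ℤˣ) : ℤ) : ℝ) * (√(cst q γ) ^ n *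
      latticeFun (q ^ (-2 : ℤ)) (cst q γ) ((q ^ (-2 : ℤ)) ^ (-(n : ℤ))) k) : ℝ) : ℂ) := by
  have hq0 : q ≠ 0 := (one_pos.trans hq).ne'
  have hb : (q ^ (-2 : ℤ)) ^ (-(n : ℤ)) = q ^ (2 * (n : ℤ)) := by
    rw [← zpow_mul, neg_mul_neg]
  have hbr : q ^ (2 * (n : ℤ)) * q ^ (-2 : ℤ) = q ^ (2 * (n : ℤ) - 2) := (zpow_add₀ hq0 _ _).symm
  have hpt : pt q γ σ k ^ n = (((σ ^ n : ℤˣ) : ℤ) : ℝ) * √(cst q γ) ^ n *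
      (q ^ (2 * (n : ℤ))) ^ (-k) := by
    rw [pt, mul_pow, mul_pow, ← zpow_natCast (q ^ _), ← zpow_mul, ← zpow_mul,
      show -2 * k * n = 2 * (n : ℤ) * -k by ring]
    norm_cast
  rw [hTilde, neg_div_pt_sq_eq_node hq, hpt, ← mul_assoc, Complex.ofReal_mul,
    Complex.ofReal_mul _ (latticeFun _ _ _ _), hb, ← zpow_mul_phi21_node hq (cst_pos hq γ), hbr,
    mul_assoc]

theorem weight_eq (q γ : ℝ) (k : ℤ) :
    weight q γ k = latticeWeight (q ^ (-2 : ℤ)) (cst q γ) k := by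
  rw [weight, latticeWeight, zpow_neg_two_sq, ← zpow_mul, ← zpow_mul,
    show -2 * (2 * k) = -4 * k by ring]

theorem normSq_eq (hq : 1 < q) (γ : ℝ) (m : ℤ) :
    normSq q γ m = 2 * halfNorm (q ^ (-2 : ℤ)) (cst q γ) m := by
  have hpow : q ^ (2 * m ^ 2) = (q ^ (-2 : ℤ)) ^ (-(m ^ 2)) := by rw [← zpow_mul, neg_mul_neg]
  have hpow' : q ^ (-2 * m - 2) = (q ^ (-2 : ℤ)) ^ (m + 1) := by
    rw [← zpow_mul, mul_add, mul_one, sub_eq_add_neg]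
  have hdiv : (q ^ (-2 : ℤ)) ^ 2 / -(cst q γ * q ^ (-2 : ℤ)) =
      -((cst q γ)⁻¹ * q ^ (-2 : ℤ)) := by
    field_simp
  have hdiv' : (q ^ (-2 : ℤ)) ^ 2 / -cst q γ = -((cst q γ)⁻¹ * (q ^ (-2 : ℤ)) ^ 2) := by
    rw [div_neg, inv_mul_eq_div]
  rw [normSq, halfNorm, Mc, hpow, hpow', ← zpow_neg_two_sq, qTheta, qTheta, hdiv, hdiv']
  ring

theorem sum_units_zpow (l : ℤ) :
    ∑ σ : ℤˣ, (((σ ^ l : ℤˣ) : ℤ) : ℝ) = if Even l then 2 else 0 := by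
  rw [show (Finset.univ : Finset ℤˣ) = {1, -1} from rfl, Finset.sum_pair (by decide), one_zpow]
  split_ifs with hl
  · rw [hl.neg_one_zpow]
    norm_num
  · rw [(Int.not_even_iff_odd.mp hl).neg_one_zpow]
    norm_num

theorem hasSum_mul_fintype {ι κ : Type*} [Fintype κ] {g : ι → ℝ} {S : ℝ} (hg : HasSum g S)
    (χ : κ → ℝ) :
    HasSum (fun i : ι × κ => ((g i.1 * χ i.2 : ℝ) : ℂ)) ((S * ∑ σ, χ σ : ℝ) : ℂ) := by
  have hχ := hasSum_fintype χ
  exact Complex.hasSum_ofReal.mpr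
    (hg.mul hχ (summable_mul_of_summable_norm hg.summable.norm hχ.summable.norm))

theorem hasSum_mul_units_zpow {g : ℤ → ℝ} {S : ℝ} (hg : HasSum g S) (l : ℤ) :
    HasSum (fun i : ℤ × ℤˣ => ((g i.1 * (((i.2 ^ l : ℤˣ) : ℤ) : ℝ) : ℝ) : ℂ))
      ((if Even l then 2 * S else 0 : ℝ) : ℂ) := by
  have hprod := hasSum_mul_fintype hg fun σ : ℤˣ => (((σ ^ l : ℤˣ) : ℤ) : ℝ)
  rwa [sum_units_zpow, mul_ite, mul_zero, mul_comm S] at hprod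

end Conversion

/-! ### Orthogonality on the extended lattice -/

section Vanishing

variable {r : ℝ}

theorem valueLim_zpow_neg_of_odd (h0 : 0 < r) (h1 : r < 1) (c : ℝ) {n : ℕ} (hn : Odd n) :
    valueLim r c (r ^ (-(n : ℤ))) = 0 := by
  obtain ⟨i, rfl⟩ := hn
  have h : r ^ (-((2 * i + 1 : ℕ) : ℤ)) * r * (r ^ 2) ^ i = 1 := by
    rw [← pow_mul, mul_assoc, ← pow_succ', zpow_neg, zpow_natCast,
      inv_mul_cancel₀ (pow_ne_zero _ h0.ne')]
  rw [valueLim, qPochInf_eq_zero (norm_sq_lt_one (norm_lt_one_of_pos h0 h1)) h, zero_div, zero_mul]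

theorem slopeLim_zpow_neg_of_even (h0 : 0 < r) (h1 : r < 1) (c : ℝ) {n : ℕ} (hn : Even n) :
    slopeLim r c (r ^ (-(n : ℤ))) = 0 := by
  cases n with
  | zero => simp [slopeLim]
  | succ n =>
    have hodd : Odd n := by grind
    have hshift : r ^ (-((n + 1 : ℕ) : ℤ)) * r = r ^ (-(n : ℤ)) := by
      rw [← zpow_add_one₀ h0.ne', Nat.cast_succ, neg_add_rev, neg_add_cancel_comm]
    rw [slopeLim, hshift, valueLim_zpow_neg_of_odd h0 h1 c hodd, mul_zero]

theorem wronskianLim_param_param (h0 : 0 < r) (h1 : r < 1) {c : ℝ} (hc : 0 < c) {m n : ℤ}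
    (h : Even (m + 1 + (n + 1))) : wronskianLim r c (param r c m) (param r c n) = 0 := by
  rw [wronskianLim]
  rcases Int.even_or_odd m with hm | hm
  · have hn : Even n := by grind
    rw [valueLim_param_of_even h0 h1 hc hm, valueLim_param_of_even h0 h1 hc hn]
    ring
  · have hn : Odd n := by grind
    rw [slopeLim_param_of_odd h0 h1 hc hm, slopeLim_param_of_odd h0 h1 hc hn]
    ring

theorem wronskianLim_zpow_neg_param (h0 : 0 < r) (h1 : r < 1) {c : ℝ} (hc : 0 < c) {n : ℕ} {m : ℤ}
    (h : Even ((n : ℤ) + (m + 1))) : wronskianLim r c (r ^ (-(n : ℤ))) (param r c m) = 0 := by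
  rw [wronskianLim]
  rcases Nat.even_or_odd n with hn | hn
  · have hm : Odd m := by grind
    rw [slopeLim_zpow_neg_of_even h0 h1 c hn, slopeLim_param_of_odd h0 h1 hc hm]
    ring
  · have hm : Even m := by grind
    rw [valueLim_zpow_neg_of_odd h0 h1 c hn, valueLim_param_of_even h0 h1 hc hm]
    ring

theorem hasSum_latticeFun_mul_units_zpow (h0 : 0 < r) (h1 : r < 1) {c b b' : ℝ} (hc : 0 < c)
    (hb : b ≠ 0) (hb' : b' ≠ 0) (hne : b ≠ b') {l : ℤ} (h : Even l → wronskianLim r c b b' = 0) :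
    HasSum (fun i : ℤ × ℤˣ => ((latticeFun r c b i.1 * latticeFun r c b' i.1 *
      latticeWeight r c i.1 * (((i.2 ^ l : ℤˣ) : ℤ) : ℝ) : ℝ) : ℂ)) 0 := by
  by_cases hl : Even l
  · have hsum := hasSum_mul_units_zpow
      (hasSum_latticeFun_mul_eq_zero h0 h1 hc hb hb' hne (h hl)) l
    rwa [mul_zero, ite_self, Complex.ofReal_zero] at hsum
  · have hsum := hasSum_mul_units_zpow (summable_latticeFun_mul h0 h1 hc hb hb').hasSum l
    rwa [if_neg hl, Complex.ofReal_zero] at hsum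

end Vanishing

section Orthogonality

variable {q : ℝ}

theorem kTilde_equation (hq : 1 < q) (γ : ℝ) (m : ℤ) (σ : ℤˣ) (k : ℤ) :
    ((q + q⁻¹ - q * eps q γ m * pt q γ σ k ^ 2 : ℝ) : ℂ) * kTilde q γ m σ k
      - (q : ℂ)⁻¹ * kTilde q γ m σ (k - 1)
      - (q : ℂ) * ((1 + pt q γ σ k ^ 2 : ℝ) : ℂ) * kTilde q γ m σ (k + 1) = 0 := by
  have hq0 : q ≠ 0 := (one_pos.trans hq).ne'
  have hr := zpow_neg_two_pos hq
  have hrec := latticeFun_recurrence hr (zpow_neg_two_lt_one hq) (cst_pos hq γ)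
    (param_ne_zero hr (cst_pos hq γ) m) k
  have hε : eps q γ m = -(param (q ^ (-2 : ℤ)) (cst q γ) m)⁻¹ := by
    rw [← neg_eps_eq hq, neg_neg]
  have hqr : q⁻¹ = q * q ^ (-2 : ℤ) := by
    rw [← zpow_one_add₀ hq0, ← zpow_neg_one]
    norm_num
  rw [kTilde_eq hq, kTilde_eq hq, kTilde_eq hq, pt_sq hq, hε, ← Complex.ofReal_inv, hqr]
  generalize q ^ (-2 : ℤ) = r at *
  norm_cast
  generalize (((σ ^ (m + 1) : ℤˣ) : ℤ) : ℝ) = s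
  rw [div_eq_mul_inv] at hrec
  linear_combination q * s * hrec

theorem kTilde_mul_kTilde (hq : 1 < q) (γ : ℝ) (m n : ℤ) (σ : ℤˣ) (k : ℤ) :
    kTilde q γ m σ k * kTilde q γ n σ k * (weight q γ k : ℂ) =
      ((latticeFun (q ^ (-2 : ℤ)) (cst q γ) (param (q ^ (-2 : ℤ)) (cst q γ) m) k *
        latticeFun (q ^ (-2 : ℤ)) (cst q γ) (param (q ^ (-2 : ℤ)) (cst q γ) n) k *
        latticeWeight (q ^ (-2 : ℤ)) (cst q γ) k *
        (((σ ^ (m + 1 + (n + 1)) : ℤˣ) : ℤ) : ℝ) : ℝ) : ℂ) := by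
  rw [kTilde_eq hq, kTilde_eq hq, weight_eq, zpow_add σ (m + 1) (n + 1), Units.val_mul]
  push_cast
  ring

theorem hTilde_mul_kTilde (hq : 1 < q) (γ : ℝ) (n : ℕ) (m : ℤ) (σ : ℤˣ) (k : ℤ) :
    hTilde q n (pt q γ σ k) * kTilde q γ m σ k * (weight q γ k : ℂ) =
      ((√(cst q γ) ^ n : ℝ) : ℂ) *
        ((latticeFun (q ^ (-2 : ℤ)) (cst q γ) ((q ^ (-2 : ℤ)) ^ (-(n : ℤ))) k *
          latticeFun (q ^ (-2 : ℤ)) (cst q γ) (param (q ^ (-2 : ℤ)) (cst q γ) m) k *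
          latticeWeight (q ^ (-2 : ℤ)) (cst q γ) k *
          (((σ ^ ((n : ℤ) + (m + 1)) : ℤˣ) : ℤ) : ℝ) : ℝ) : ℂ) := by
  rw [hTilde_eq hq, kTilde_eq hq, weight_eq, zpow_add σ (n : ℤ) (m + 1), Units.val_mul,
    zpow_natCast]
  push_cast
  ring

theorem hasSum_kTilde (hq : 1 < q) (γ : ℝ) (m n : ℤ) :
    HasSum (fun i : ℤ × ℤˣ =>
      kTilde q γ m i.2 i.1 * kTilde q γ n i.2 i.1 * (weight q γ i.1 : ℂ))
      (if m = n then (normSq q γ m : ℂ) else 0) := by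
  have h0 := zpow_neg_two_pos hq
  have h1 := zpow_neg_two_lt_one hq
  have hc := cst_pos hq γ
  simp only [kTilde_mul_kTilde hq]
  split_ifs with hmn
  · subst hmn
    have hsum := hasSum_mul_units_zpow (hasSum_latticeFun_param_sq h0 h1 hc m) (m + 1 + (m + 1))
    rwa [if_pos (Even.add_self _), ← normSq_eq hq] at hsum
  · exact hasSum_latticeFun_mul_units_zpow h0 h1 hc (param_ne_zero h0 hc m) (param_ne_zero h0 hc n)
      ((param_injective h0 h1 hc).ne hmn) (wronskianLim_param_param h0 h1 hc)

theorem hasSum_hTilde_mul_kTilde (hq : 1 < q) (γ : ℝ) (n : ℕ) (m : ℤ) :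
    HasSum (fun i : ℤ × ℤˣ =>
      hTilde q n (pt q γ i.2 i.1) * kTilde q γ m i.2 i.1 * (weight q γ i.1 : ℂ)) 0 := by
  have h0 := zpow_neg_two_pos hq
  have h1 := zpow_neg_two_lt_one hq
  have hc := cst_pos hq γ
  have hpos : 0 < (q ^ (-2 : ℤ)) ^ (-(n : ℤ)) := zpow_pos h0 _
  have hneg : param (q ^ (-2 : ℤ)) (cst q γ) m < 0 := neg_neg_of_pos (mul_pos hc (zpow_pos h0 _))
  have hsum := (hasSum_latticeFun_mul_units_zpow h0 h1 hc hpos.ne' hneg.ne (hneg.trans hpos).ne'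
    (wronskianLim_zpow_neg_param h0 h1 hc)).mul_left ((√(cst q γ) ^ n : ℝ) : ℂ)
  simpa only [hTilde_mul_kTilde hq, mul_zero] using hsum

end Orthogonality

section PrincipalValue

variable {q : ℝ}

/-- The unimodular factor `(-σ)^{m-γ}` (principal value) by which the prefactor of `kPrincipal` at
`pt q γ σ k` differs from `ε_m ^ k`. -/
noncomputable def phase (γ : ℝ) (m : ℤ) (σ : ℤˣ) : ℂ :=
  (-((σ : ℤ) : ℂ)) ^ (((m : ℝ) - γ : ℝ) : ℂ)

theorem conj_phase_mul_phase (γ : ℝ) (m n : ℤ) (σ : ℤˣ) :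
    (starRingEnd ℂ) (phase γ m σ) * phase γ n σ =
      (-1) ^ (m + n) * (((σ ^ (m + 1 + (n + 1)) : ℤˣ) : ℤ) : ℂ) := by
  have hneg : (-1 : ℂ) ≠ 0 := by norm_num
  rcases Int.units_eq_one_or σ with rfl | rfl
  · have hexp : (starRingEnd ℂ) (Real.pi * Complex.I * (((m : ℝ) - γ : ℝ) : ℂ)) +
        Real.pi * Complex.I * (((n : ℝ) - γ : ℝ) : ℂ) =
        ((n - m : ℤ) : ℂ) * (Real.pi * Complex.I) := by
      simp only [map_mul, Complex.conj_I, Complex.conj_ofReal]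
      push_cast
      ring
    rw [one_zpow, phase, phase, Units.val_one, Int.cast_one, Complex.cpow_def_of_ne_zero hneg,
      Complex.cpow_def_of_ne_zero hneg, Complex.log_neg_one, ← Complex.exp_conj,
      ← Complex.exp_add, hexp, Complex.exp_int_mul, Complex.exp_pi_mul_I,
      show m + n = n - m + (m + m) by ring, zpow_add₀ hneg, (Even.add_self m).neg_one_zpow, mul_one,
      mul_one]
  · have hsign : ((((-1) ^ (m + 1 + (n + 1)) : ℤˣ) : ℤ) : ℂ) = (-1) ^ (m + n) := by
      rw [show m + 1 + (n + 1) = m + n + 2 by ring, zpow_add, even_two.neg_one_zpow, mul_one]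
      rcases Int.even_or_odd (m + n) with h | h <;> simp [h.neg_one_zpow]
    rw [hsign, ← mul_zpow, neg_one_mul, neg_neg, one_zpow]
    simp [phase]

theorem cpow_mul_sqrt_cst_rpow (hq : 1 < q) (γ : ℝ) (m : ℤ) (σ : ℤˣ) (k : ℤ) :
    ((-pt q γ σ k : ℝ) : ℂ) ^ (((m : ℝ) - γ : ℝ) : ℂ) *
      ((√(cst q γ) ^ (γ - (m : ℝ)) : ℝ) : ℂ) = phase γ m σ * ((eps q γ m ^ k : ℝ) : ℂ) := by
  have hq0 : 0 < q := one_pos.trans hq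
  have hs : 0 < √(cst q γ) := Real.sqrt_pos.mpr (cst_pos hq γ)
  have hx : 0 < √(cst q γ) * q ^ (-2 * k) := mul_pos hs (zpow_pos hq0 _)
  have habs : (√(cst q γ) * q ^ (-2 * k)) ^ ((m : ℝ) - γ) * √(cst q γ) ^ (γ - (m : ℝ)) =
      eps q γ m ^ k := by
    rw [Real.mul_rpow hs.le (zpow_pos hq0 _).le, mul_right_comm, ← Real.rpow_add hs,
      ← neg_sub γ, neg_add_cancel, Real.rpow_zero, one_mul, eps, ← Real.rpow_intCast q (-2 * k),
      ← Real.rpow_mul hq0.le, ← Real.rpow_intCast _ k, ← Real.rpow_mul hq0.le]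
    congr 1
    push_cast
    ring
  rw [← habs, Complex.ofReal_mul, Complex.ofReal_cpow hx.le, ← mul_assoc]
  congr 1
  rcases Int.units_eq_one_or σ with rfl | rfl
  · have hpt : -pt q γ 1 k = -(√(cst q γ) * q ^ (-2 * k)) := by simp [pt]
    rw [hpt, Complex.ofReal_cpow_of_nonpos (neg_nonpos.mpr hx.le), Complex.ofReal_neg, neg_neg,
      mul_comm, phase, Units.val_one, Int.cast_one,
      Complex.cpow_def_of_ne_zero (neg_ne_zero.mpr one_ne_zero), Complex.log_neg_one]
  · have hpt : -pt q γ (-1) k = √(cst q γ) * q ^ (-2 * k) := by simp [pt]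
    rw [hpt, phase, Units.val_neg, Units.val_one, Int.cast_neg, neg_neg, Int.cast_one,
      Complex.one_cpow, one_mul]

theorem conj_kPhi (hq : 1 < q) (γ : ℝ) (m : ℤ) (σ : ℤˣ) (k : ℤ) :
    (starRingEnd ℂ) (kPhi q γ m (pt q γ σ k)) = kPhi q γ m (pt q γ σ k) := by
  have hne : (((-eps q γ m) ^ k : ℝ) : ℂ) ≠ 0 := by
    rw [neg_eps_eq hq, Complex.ofReal_ne_zero]
    exact zpow_ne_zero k (inv_ne_zero (param_ne_zero (zpow_neg_two_pos hq) (cst_pos hq γ) m))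
  have hreal := zpow_mul_kPhi_pt hq γ m σ k
  rw [mul_comm, ← eq_div_iff hne, ← Complex.ofReal_div] at hreal
  rw [hreal, Complex.conj_ofReal]

theorem conj_kPrincipal_mul (hq : 1 < q) (γ : ℝ) (m n : ℤ) (σ : ℤˣ) (k : ℤ) :
    (starRingEnd ℂ) (kPrincipal q γ m (pt q γ σ k)) * kPrincipal q γ n (pt q γ σ k) =
      (-1) ^ (m + n) * (kTilde q γ m σ k * kTilde q γ n σ k) := by
  have hphase := conj_phase_mul_phase γ m n σ
  rw [zpow_add σ (m + 1) (n + 1), Units.val_mul, Int.cast_mul] at hphase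
  have hε : (((-eps q γ m) ^ k : ℝ) : ℂ) * (((-eps q γ n) ^ k : ℝ) : ℂ) =
      ((eps q γ m ^ k : ℝ) : ℂ) * ((eps q γ n ^ k : ℝ) : ℂ) := by
    rw [← Complex.ofReal_mul, ← Complex.ofReal_mul, ← mul_zpow, ← mul_zpow, neg_mul_neg]
  rw [kPrincipal, kPrincipal, cpow_mul_sqrt_cst_rpow hq, cpow_mul_sqrt_cst_rpow hq, map_mul,
    map_mul, Complex.conj_ofReal, conj_kPhi hq, kTilde, kTilde, Complex.ofReal_mul,
    Complex.ofReal_mul, Complex.ofReal_intCast, Complex.ofReal_intCast]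
  generalize kPhi q γ m (pt q γ σ k) = A at *
  generalize kPhi q γ n (pt q γ σ k) = B at *
  linear_combination ((eps q γ m ^ k : ℝ) : ℂ) * ((eps q γ n ^ k : ℝ) : ℂ) * A * B * hphase -
    (-1) ^ (m + n) * (((σ ^ (m + 1) : ℤˣ) : ℤ) : ℂ) * (((σ ^ (n + 1) : ℤˣ) : ℤ) : ℂ) * A * B * hε

theorem hasSum_kPrincipal (hq : 1 < q) (γ : ℝ) (m n : ℤ) :
    HasSum (fun i : ℤ × ℤˣ =>
      (starRingEnd ℂ) (kPrincipal q γ m (pt q γ i.2 i.1)) * kPrincipal q γ n (pt q γ i.2 i.1) *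
        (weight q γ i.1 : ℂ))
      (if m = n then (normSq q γ m : ℂ) else 0) := by
  have hsum := (hasSum_kTilde hq γ m n).mul_left ((-1) ^ (m + n))
  have hval : (-1 : ℂ) ^ (m + n) * (if m = n then (normSq q γ m : ℂ) else 0) =
      if m = n then (normSq q γ m : ℂ) else 0 := by
    split_ifs with hmn
    · rw [hmn, (Even.add_self n).neg_one_zpow, one_mul]
    · rw [mul_zero]
  rw [hval] at hsum
  simpa only [conj_kPrincipal_mul hq, mul_assoc] using hsum

end PrincipalValue

end QOscillator

theorem mainTheorem2 (q γ : ℝ) (hq : 1 < q) :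
    -- all the values on the extended lattice are real
    (∀ (m : ℤ) (σ : ℤˣ) (k : ℤ), (QOscillator.kTilde q γ m σ k).im = 0) ∧
    (∀ (n : ℕ) (σ : ℤˣ) (k : ℤ), (QOscillator.hTilde q n (QOscillator.pt q γ σ k)).im = 0) ∧
    -- `k̃_m` solves the eigenvalue equation with `ε = q^{2γ-2m}` on the extended lattice
    (∀ (m : ℤ) (σ : ℤˣ) (k : ℤ),
      ((q + q⁻¹ - q * QOscillator.eps q γ m * QOscillator.pt q γ σ k ^ 2 : ℝ) : ℂ) *
            QOscillator.kTilde q γ m σ k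
          - (q : ℂ)⁻¹ * QOscillator.kTilde q γ m σ (k - 1)
          - (q : ℂ) * ((1 + QOscillator.pt q γ σ k ^ 2 : ℝ) : ℂ) *
            QOscillator.kTilde q γ m σ (k + 1) = 0) ∧
    -- orthogonality and norms of the `k̃_m`
    (∀ m n : ℤ,
      HasSum (fun i : ℤ × ℤˣ =>
          QOscillator.kTilde q γ m i.2 i.1 * QOscillator.kTilde q γ n i.2 i.1 *
            (QOscillator.weight q γ i.1 : ℂ))
        (if m = n then (QOscillator.normSq q γ m : ℂ) else 0)) ∧
    -- orthogonality of `h̃_n` and `k̃_m`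
    (∀ (n : ℕ) (m : ℤ),
      HasSum (fun i : ℤ × ℤˣ =>
          QOscillator.hTilde q n (QOscillator.pt q γ i.2 i.1) *
            QOscillator.kTilde q γ m i.2 i.1 * (QOscillator.weight q γ i.1 : ℂ)) 0) ∧
    -- with the prefactor `(-x)^{m-γ} √c^{γ-m}` (principal value of the power) and complex conjugation
    -- in the first argument, orthogonality and norms of the `k̃_m` hold as well
    (∀ m n : ℤ,
      HasSum (fun i : ℤ × ℤˣ =>
          (starRingEnd ℂ) (QOscillator.kPrincipal q γ m (QOscillator.pt q γ i.2 i.1)) *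
            QOscillator.kPrincipal q γ n (QOscillator.pt q γ i.2 i.1) *
            (QOscillator.weight q γ i.1 : ℂ))
        (if m = n then (QOscillator.normSq q γ m : ℂ) else 0)) := by
  refine ⟨fun m σ k => ?_, fun n σ k => ?_, QOscillator.kTilde_equation hq γ,
    QOscillator.hasSum_kTilde hq γ, QOscillator.hasSum_hTilde_mul_kTilde hq γ,
    QOscillator.hasSum_kPrincipal hq γ⟩
  · rw [QOscillator.kTilde_eq hq, Complex.ofReal_im]
  · rw [QOscillator.hTilde_eq hq, Complex.ofReal_im]
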